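/- **Setting.** All matrices are complex. Let $L\ge 1$ and $N\ge 0$. An $L\times N\times N$ state is an $L$-tuple $\psi=(\Gamma_1,\dots,\Gamma_L)$ of $N\times N$ matrices. For $T\in\mathbb C^{L\times L}$ put $T\psi=(\sum_jT_{ij}\Gamma_j)_i$. Two states are *SLOCC equivalent* if $\sum_j T_{ij}P\Gamma_jQ=\Gamma_i'$ for all $i$, with invertible $T,P,Q$; they are *$PQ$-equivalent* if this holds with $T=E$ (the identity matrix). **Triples.** A parameter set $\vec{\mathbf a}$ consists of sizes $n_1,\dots,n_r\ge1$, numbers $\lambda_1,\dots,\lambda_r$, and numbers $a_{ijk}$ ($1\le i,j\le r$, $0\le k<\min(n_i,n_j)$) with $a_{ijk}=0$ whenever $\lambda_i\ne\lambda_j$. It defines the Jordan matrix $J=\bigoplus_iJ_{n_i}(\lambda_i)$ and the matrix $A$ whose $(i,j)$ block is the $n_i\times n_j$ upper-triangular Toeplitz block with entry $a_{ij,\,q-p-s}$ at $(p,q)$ if $q\ge p+s$, $s=\max(0,n_j-n_i)$, and $0$ otherwise. A commuting pair $(A_2,A_3)$ has canonical form $(E,J,A)$ if $(A_2,A_3)$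 is simultaneously similar to $(J,A)$. **Composed pair.** Let $l=L-1$. For $\gamma=(\gamma_2,\dots,\gamma_L)$, $n\times n$ matrices, let $X$, $Y_\gamma$ be the matrices of multiplication by $x$ and $y$ on the space with basis $x^ay^b\otimes e_p$ ($0\le b<l$, $a\ge 0$, $a+b\le l$, $1\le p\le n$), where monomials of degree $l+1$ are $0$ and $y^l\otimes v=\sum_{b=0}^{l-1}x^{l-b}y^b\otimes\gamma_{b+2}v$. **Canonical forms of states.** Canonical data $c=(n,m,i,\vec{\mathbf a},\beta_2,\dots,\beta_L)$ consist of integers $n,m\ge 0$, $0\le i\le m$, a parameter set and $m\times m$ matrices $\beta_j$; put $\Lambda'=\operatorname{diag}(E_{m-i},0_{i\times i})$. The data $c$ are a canonical form of $\psi$ if there are an invertible $T$ such that the first matrix of $T\psi$ has the maximum rank among the linear combinations of the $\Gamma_j$, and $n\times n$ matrices $\gamma_j$, such that * $T\psi$ is $PQ$-equivalent to $(E\oplus\Lambda',\gamma_2\oplus\beta_2,\dots,\gamma_L\oplus\beta_L)$; * no nontrivial direct summand with first matrix $E$ can be split off from $(\Lambda',\beta_2,\dots,\beta_L)$ by $PQ$-equivalence;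 * $(X,Y_\gamma)$ has the canonical form $(E,J,A)$ with parameters $\vec{\mathbf a}$. **Symmetry $\mathcal P$.** $c\sim_{\mathcal P}c'$ means: $n=n'$, and there are an invertible $T$ and $\gamma$ such that $(X,Y_\gamma)$ has canonical form with parameters $\vec{\mathbf a}$; $G=T_{11}E+\sum_{j\ge2}T_{1j}\gamma_j$ is invertible; for $\gamma'_i=G^{-1}(T_{i1}E+\sum_{j\ge 2}T_{ij}\gamma_j)$ the pair $(X,Y_{\gamma'})$ has canonical form with parameters $\vec{\mathbf a}'$; and $T(\Lambda',\beta_2,\dots,\beta_L)$ is $PQ$-equivalent to the tuple $(\Lambda',\beta'_2,\dots,\beta'_L)$ of $c'$, whose $\Lambda'$ is formed from the $m',i'$ of $c'$. **Theorem.** 1. $[J,A]=0$ for every parameter set. 2. $X$ and $Y_\gamma$ commute. For $\gamma,\gamma'$ of the same size $n$ the following are equivalent: $(E,\gamma_2,\dots,\gamma_L)$ and $(E,\gamma_2',\dots,\gamma_L')$ are $PQ$-equivalent; $\gamma$ and $\gamma'$ are simultaneously similar; $(X,Y_\gamma)$ and $(X,Y_{\gamma'})$ are simultaneously similar. 3.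 Every $L\times N\times N$ state has a canonical form. 4. For every canonical form $c$ of $\psi$: $n+m=N$; the maximum rank of linear combinations of the $\Gamma_j$ is $N-i$; $i=0$ if and only if $m=0$ (in the full-rank case there are no $\beta$-blocks); $\max_{\alpha}r(\Lambda'+\sum_{j\ge 2}\alpha_j\beta_j)=m-i$; if the $\beta_j$ are not all $0$, then $m>i$; and if $i>0$ and the $\Gamma_j$ have no common nonzero right null vector or no common nonzero left null vector, then the $\beta_j$ are not all $0$. 5. If $c$, $c'$ are any canonical forms of $\psi$, $\psi'$ (of the same format $L\times N\times N$), then $\psi$ and $\psi'$ are SLOCC equivalent if and only if $c\sim_{\mathcal P}c'$. 6. Let $L=3$. If $\Gamma_1$ is invertible and $[\Gamma_1^{-1}\Gamma_2,\Gamma_1^{-1}\Gamma_3]=0$, then $\psi$ is $PQ$-equivalent to some $(E,J,A)$. 7. Let $L=3$ and let $\psi$, $\psi'$ (of the same format) be $PQ$-equivalent to $(E,J,A)$, $(E,J',A')$ with parameters $\vec{\mathbf a}$, $\vec{\mathbf a}'$. (a) $\psi$ and $\psi'$ are SLOCC equivalent if and only if for some invertible $T$ the matrix $G=T_{11}E+T_{12}J+T_{13}A$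 is invertible and the pair $\bigl(G^{-1}(T_{21}E+T_{22}J+T_{23}A),\,G^{-1}(T_{31}E+T_{32}J+T_{33}A)\bigr)$ is simultaneously similar to $(J',A')$. (b) If moreover the $\lambda_i$ are pairwise distinct and so are the $\lambda'_i$, this holds if and only if there are an invertible $T$ and a bijection $\sigma$ of the blocks with $n'_{\sigma(i)}=n_i$ such that, with $f_{k,i}(x)=T_{k1}+T_{k2}(\lambda_i+x)+T_{k3}\sum_{d<n_i}a_{iid}x^d$ for $k=1,2,3$, for every $i$ one has $f_{1,i}(0)\neq0$ and there is a polynomial $g$ with $g(0)=0$, $g'(0)\ne0$ and $$f_{2,i}(g(x))\equiv(\lambda'_{\sigma(i)}+x)\,f_{1,i}(g(x)),\qquad f_{3,i}(g(x))\equiv\Bigl(\sum_{d<n_i}a'_{\sigma(i)\sigma(i)d}\,x^d\Bigr)f_{1,i}(g(x))\pmod{x^{n_i}}.$$ -/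

import Mathlib

/-- An invertible local operator: a matrix with a two-sided inverse.  The two index types may differ
(they then have the same number of elements), so that the operator can also relabel the basis. -/
def IsILO {κ ι : Type} [Fintype κ] [DecidableEq κ] [Fintype ι] [DecidableEq ι]
    (P : Matrix κ ι ℂ) : Prop :=
  ∃ R : Matrix ι κ ℂ, P * R = 1 ∧ R * P = 1

/-- The action of a matrix `T` on the first party of the state `(Γ₁, …, Γ_L)`. -/
noncomputable def applyT {L : ℕ} {ι : Type} (T : Matrix (Fin L) (Fin L) ℂ)
    (Γ : Fin L → Matrix ι ι ℂ) : Fin L → Matrix ι ι ℂ :=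
  fun i => ∑ j, T i j • Γ j

/-- SLOCC equivalence of two states given as tuples of matrices. -/
def SLOCCEquiv {L : ℕ} {ι κ : Type} [Fintype ι] [DecidableEq ι] [Fintype κ] [DecidableEq κ]
    (Γ : Fin L → Matrix ι ι ℂ) (Γ' : Fin L → Matrix κ κ ℂ) : Prop :=
  ∃ (T : Matrix (Fin L) (Fin L) ℂ) (P : Matrix κ ι ℂ) (Q : Matrix ι κ ℂ),
    IsILO T ∧ IsILO P ∧ IsILO Q ∧ ∀ i, ∑ j, T i j • (P * Γ j * Q) = Γ' i

/-- Equivalence under invertible operators on the second and third party only. -/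
def PQEquiv {L : ℕ} {ι κ : Type} [Fintype ι] [DecidableEq ι] [Fintype κ] [DecidableEq κ]
    (Γ : Fin L → Matrix ι ι ℂ) (Γ' : Fin L → Matrix κ κ ℂ) : Prop :=
  ∃ (P : Matrix κ ι ℂ) (Q : Matrix ι κ ℂ),
    IsILO P ∧ IsILO Q ∧ ∀ j, P * Γ j * Q = Γ' j

/-- Simultaneous similarity of two tuples of matrices. -/
def SimSimilar {l : ℕ} {ι κ : Type} [Fintype ι] [DecidableEq ι] [Fintype κ] [DecidableEq κ]
    (Γ : Fin l → Matrix ι ι ℂ) (Γ' : Fin l → Matrix κ κ ℂ) : Prop :=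
  ∃ (P : Matrix κ ι ℂ) (R : Matrix ι κ ℂ),
    P * R = 1 ∧ R * P = 1 ∧ ∀ j, P * Γ j * R = Γ' j

/-- The blockwise direct sum of two tuples of matrices. -/
def tupleSum {L : ℕ} {ι κ : Type} (Γ : Fin L → Matrix ι ι ℂ) (B : Fin L → Matrix κ κ ℂ) :
    Fin L → Matrix (ι ⊕ κ) (ι ⊕ κ) ℂ :=
  fun j => Matrix.fromBlocks (Γ j) 0 0 (B j)

/-- The tuple `(M, Γ₂, …, Γ_L)` with `L = l + 1`. -/
def consTuple {l : ℕ} {ι : Type} (M : Matrix ι ι ℂ) (Γ : Fin l → Matrix ι ι ℂ) :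
    Fin (l + 1) → Matrix ι ι ℂ :=
  Fin.cons M Γ

/-- The first matrix of the tuple has the maximum rank among all linear combinations. -/
def FirstHasMaxRank {l : ℕ} {ι : Type} [Fintype ι] [DecidableEq ι]
    (Γ : Fin (l + 1) → Matrix ι ι ℂ) : Prop :=
  ∀ t : Fin (l + 1) → ℂ, (∑ j, t j • Γ j).rank ≤ (Γ 0).rank

/-! ### The triple `(E, J, A)` and its parameters -/

/-- The Jordan block `J_n(lam)`: `lam` on the diagonal, `1` on the superdiagonal. -/
def jordanBlock (n : ℕ) (lam : ℂ) : Matrix (Fin n) (Fin n) ℂ :=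
  Matrix.of fun p q =>
    if p = q then lam else if (p : ℕ) + 1 = (q : ℕ) then 1 else 0

/-- The parameters of a triple `(E, J, A)`: sizes and eigenvalues of the Jordan blocks of `J`, and
for every ordered pair of blocks with the same eigenvalue the entries of an upper triangular
Toeplitz block of `A` (blocks of `A` between different eigenvalues vanish). -/
structure EJAParams where
  /-- the number of Jordan blocks -/
  r : ℕ
  size : Fin r → ℕ
  size_pos : ∀ i, 0 < size i
  eig : Fin r → ℂ
  toep : (i j : Fin r) → Fin (min (size i) (size j)) → ℂ
  toep_eq_zero : ∀ i j, eig i ≠ eig j → toep i j = 0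

namespace EJAParams

/-- The index type of the matrices `J` and `A`: pairs (block, position in the block). -/
abbrev Idx (p : EJAParams) : Type := Σ i : Fin p.r, Fin (p.size i)

/-- The Jordan matrix `J`. -/
def J (p : EJAParams) : Matrix p.Idx p.Idx ℂ :=
  Matrix.blockDiagonal' fun i => jordanBlock (p.size i) (p.eig i)

/-- The matrix `A`.  Its `(i, j)` block is the upper triangular Toeplitz matrix with entries
`toep i j`, of size `size i × size j`; rows of zeros are appended below if `size i > size j`, columns
of zeros are prepended on the left if `size i < size j`. -/
def A (p : EJAParams) : Matrix p.Idx p.Idx ℂ :=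
  Matrix.of fun u v =>
    if h : (u.2 : ℕ) + (p.size v.1 - p.size u.1) ≤ (v.2 : ℕ) then
      p.toep u.1 v.1
        ⟨(v.2 : ℕ) - ((u.2 : ℕ) + (p.size v.1 - p.size u.1)), by
          have h1 := u.2.isLt
          have h2 := v.2.isLt
          omega⟩
    else 0

/-- The polynomial `∑ a_{ik} X ^ k` of the `i`-th diagonal block of `A`. -/
noncomputable def blockPoly (p : EJAParams) (i : Fin p.r) : Polynomial ℂ :=
  ∑ k : Fin (min (p.size i) (p.size i)),
    Polynomial.monomial (k : ℕ) (p.toep i i k)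

/-- No eigenvalue belongs to two Jordan blocks. -/
def Nonderogatory (p : EJAParams) : Prop := Function.Injective p.eig

end EJAParams

/-- `(E, J, A)` with parameters `p` is a canonical form of the triple `(E, A₂, A₃)`. -/
def IsEJAForm {ι : Type} [Fintype ι] [DecidableEq ι]
    (A₂ A₃ : Matrix ι ι ℂ) (p : EJAParams) : Prop :=
  SimSimilar ![A₂, A₃] ![p.J, p.A]

/-! ### The commuting pair composed of the matrices of a tuple -/

/-- Labels of the block rows and columns of the commuting pair: the label `⟨b, a⟩` stands for the
monomial `x ^ a * y ^ b`, where `b < l` and `a + b ≤ l`. -/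
abbrev MonIdx (l : ℕ) : Type := Σ b : Fin l, Fin (l - (b : ℕ) + 1)

/-- The first matrix of the commuting pair: multiplication by `x`, where monomials of degree `l + 1`
are zero. -/
def pairX (l n : ℕ) : Matrix (MonIdx l × Fin n) (MonIdx l × Fin n) ℂ :=
  Matrix.of fun u v =>
    if u.1.1 = v.1.1 ∧ (u.1.2 : ℕ) = (v.1.2 : ℕ) + 1 ∧ u.2 = v.2 then 1 else 0

/-- The second matrix of the commuting pair, composed of the matrices `γ b`: multiplication by `y`,
where monomials of degree `l + 1` are zero and `y ^ l = ∑ b, γ b x ^ (l - b) * y ^ b`. -/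
def pairY {l n : ℕ} (γ : Fin l → Matrix (Fin n) (Fin n) ℂ) :
    Matrix (MonIdx l × Fin n) (MonIdx l × Fin n) ℂ :=
  Matrix.of fun u v =>
    if (u.1.1 : ℕ) = (v.1.1 : ℕ) + 1 ∧ (u.1.2 : ℕ) = (v.1.2 : ℕ) ∧ u.2 = v.2 then 1
    else if (v.1.1 : ℕ) + 1 = l ∧ (v.1.2 : ℕ) = 0 ∧ (u.1.2 : ℕ) + (u.1.1 : ℕ) = l then
      γ u.1.1 u.2 v.2
    else 0

/-! ### Canonical data of a general state -/

/-- `Λ' = diag(1, …, 1, 0, …, 0)` of size `m`, with `i` zeros on the diagonal. -/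
def lambdaPrime (m i : ℕ) : Matrix (Fin m) (Fin m) ℂ :=
  Matrix.diagonal fun k => if (k : ℕ) < m - i then 1 else 0

/-- The data of the canonical form of an `(l + 1) × N × N` state: the size `n` of the part on which
the first matrix is the identity, the size `m` of the `β`-blocks, the rank defect `i` of the first
matrix, the parameters of `(E, J, A)`, and the `β`-blocks. -/
structure CanonicalData (l : ℕ) where
  n : ℕ
  m : ℕ
  i : ℕ
  i_le : i ≤ m
  params : EJAParams
  β : Fin l → Matrix (Fin m) (Fin m) ℂ

/-- The tuple `(Λ', β₂, …, β_L)`. -/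
def CanonicalData.betaTuple {l : ℕ} (c : CanonicalData l) :
    Fin (l + 1) → Matrix (Fin c.m) (Fin c.m) ℂ :=
  consTuple (lambdaPrime c.m c.i) c.β

/-- No nontrivial direct summand `(E, γ₂, …, γ_L)` can be split off from the tuple. -/
def NoIdentitySummand {l m : ℕ} (B : Fin (l + 1) → Matrix (Fin m) (Fin m) ℂ) : Prop :=
  ¬ ∃ (n' m' : ℕ) (γ : Fin l → Matrix (Fin n') (Fin n') ℂ)
      (D : Fin (l + 1) → Matrix (Fin m') (Fin m') ℂ),
      0 < n' ∧ PQEquiv B (tupleSum (consTuple 1 γ) D)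

/-- `c` is a canonical form of the state `Γ`: some `T` makes the first matrix one of maximum rank,
and then operators `P`, `Q` bring the state to
`(E ⊕ Λ', γ₂ ⊕ β₂, …, γ_L ⊕ β_L)`, where nothing more can be split off from the `β`-blocks, and
the commuting pair composed of the `γ`'s has the canonical form `(E, J, A)`. -/
def IsCanonicalForm {l N : ℕ} (Γ : Fin (l + 1) → Matrix (Fin N) (Fin N) ℂ)
    (c : CanonicalData l) : Prop :=
  ∃ T : Matrix (Fin (l + 1)) (Fin (l + 1)) ℂ, IsILO T ∧ FirstHasMaxRank (applyT T Γ) ∧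
    ∃ γ : Fin l → Matrix (Fin c.n) (Fin c.n) ℂ,
      PQEquiv (applyT T Γ) (tupleSum (consTuple 1 γ) c.betaTuple) ∧
      NoIdentitySummand c.betaTuple ∧
      IsEJAForm (pairX l c.n) (pairY γ) c.params

/-- The effect of `T` on `(E, γ₂, …, γ_L)` after the first matrix has been made the identity
again (meaningful if the first matrix of `applyT T (consTuple 1 γ)` is invertible). -/
noncomputable def renormalize {l : ℕ} {ι : Type} [Fintype ι] [DecidableEq ι]
    (T : Matrix (Fin (l + 1)) (Fin (l + 1)) ℂ) (γ : Fin l → Matrix ι ι ℂ) :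
    Fin l → Matrix ι ι ℂ :=
  fun j => (applyT T (consTuple 1 γ) 0)⁻¹ * applyT T (consTuple 1 γ) j.succ

/-- The parametric symmetry: one and the same invertible `T` carries the parameters of
`(E, J, A)` and the `β`-blocks of `c` to those of `c'`. -/
def ParametricSymmetry {l : ℕ} (c c' : CanonicalData l) : Prop :=
  c.n = c'.n ∧
  ∃ (T : Matrix (Fin (l + 1)) (Fin (l + 1)) ℂ) (γ : Fin l → Matrix (Fin c.n) (Fin c.n) ℂ),
    IsILO T ∧
    IsUnit (applyT T (consTuple 1 γ) 0) ∧
    IsEJAForm (pairX l c.n) (pairY γ) c.params ∧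
    IsEJAForm (pairX l c.n) (pairY (renormalize T γ)) c'.params ∧
    PQEquiv (applyT T c.betaTuple) c'.betaTuple

/-! ### States that are themselves triples of commuting matrices -/

/-- The symmetry induced on the parameters of `(E, J, A)` by the matrices `T` that act on this
triple itself. -/
def TripleSymmetry (p p' : EJAParams) : Prop :=
  ∃ T : Matrix (Fin 3) (Fin 3) ℂ, IsILO T ∧
    IsUnit (applyT T ![1, p.J, p.A] 0) ∧
    IsEJAForm (renormalize T ![p.J, p.A] 0) (renormalize T ![p.J, p.A] 1) p'

/-- The polynomial in `x = J_{n_i}(0)` which represents, on the `i`-th Jordan block, the `k`-th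
matrix of the triple obtained from `(E, J, A)` by `T`. -/
noncomputable def rowPoly (T : Matrix (Fin 3) (Fin 3) ℂ) (p : EJAParams) (k : Fin 3)
    (i : Fin p.r) : Polynomial ℂ :=
  Polynomial.C (T k 0) + Polynomial.C (T k 1) * (Polynomial.C (p.eig i) + Polynomial.X) +
    Polynomial.C (T k 2) * p.blockPoly i

/-- The same symmetry written out on the parameters `λ_i`, `a_{ik}`.  With `f_k = rowPoly T p k i`
and an invertible substitution `y = g(x)`, it reads `f₁(y) / f₀(y) = λ' + x` and
`f₂(y) / f₀(y) = ∑ a'_k x ^ k` modulo `x ^ n_i`, up to a relabelling `σ` of the blocks. -/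
def ExplicitSymmetry (p p' : EJAParams) : Prop :=
  ∃ (T : Matrix (Fin 3) (Fin 3) ℂ) (σ : Fin p.r ≃ Fin p'.r), IsILO T ∧
    ∀ i, p'.size (σ i) = p.size i ∧ (rowPoly T p 0 i).coeff 0 ≠ 0 ∧
      ∃ g : Polynomial ℂ, g.coeff 0 = 0 ∧ g.coeff 1 ≠ 0 ∧
        Polynomial.X ^ p.size i ∣ (rowPoly T p 1 i).comp g -
          (Polynomial.C (p'.eig (σ i)) + Polynomial.X) * (rowPoly T p 0 i).comp g ∧
        Polynomial.X ^ p.size i ∣ (rowPoly T p 2 i).comp g -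
          p'.blockPoly (σ i) * (rowPoly T p 0 i).comp g

/-! The core is a cancellation property of Krull–Schmidt type, `pqEquiv_of_pqEquiv_tupleSum`: if (E,
δ) ⊕ D and (E, γ) ⊕ B are PQ-equivalent and neither D nor B has an identity summand, then δ ~ γ and
D ~ B. For an equivalence P with inverse P', block multiplication gives P₁₁P'₁₁ = 1 − P₁₂P'₂₁, and
P₁₂P'₂₁ is an endomorphism of (E, γ) that factors through D. If it were not nilpotent, its Fitting
idempotent would split an identity summand off D (`NoIdentitySummand.isNilpotent`). Hence P₁₁ is
invertible, and Schur complements match D with B.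

The operator T is brought in through ranks. On a line of matrices the rank drops only at finitely
many points, so a direct sum whose first matrix has maximum rank has this property in each summand
(`FirstHasMaxRank.tupleSum`). Therefore a T linking two canonical forms keeps the first matrix of
the identity part invertible and cannot create an identity summand in the β-part
(`NoIdentitySummand.applyT`). With cancellation this yields the classification; existence follows by
choosing the identity summand as large as possible.

The tuple γ is recovered from its commuting pair because an intertwiner of two such pairs never
lowers the degree of monomials and acts on every monomial by one and the same matrix; comparing the
expansions of y^l shows that this matrix intertwines the tuples (`simSimilar_of_simSimilar_pair`). A
commuting pair is normalised by the Jordan form of its first member and the Toeplitz shape of the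
centralizer (`exists_isEJAForm`).

When no eigenvalue is repeated, all matrices of the triple are block diagonal with blocks that are
polynomials in a nilpotent Jordan block N. An intertwiner is then a block permutation, and
conjugating N by one of its blocks gives g(N): conjugation is substitution
(`exists_substitution_of_intertwine`, `exists_conj_jordanBlock`). -/

set_option linter.unusedSectionVars false

/-! ### Equivalences of tuples, linear combinations, rank of direct sums -/

section Basics

variable {ι κ μ ν : Type} [Fintype ι] [DecidableEq ι] [Fintype κ] [DecidableEq κ]
  [Fintype μ] [DecidableEq μ] [Fintype ν] [DecidableEq ν] {L l : ℕ}

theorem IsILO.one : IsILO (1 : Matrix ι ι ℂ) := ⟨1, by simp, by simp⟩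

theorem IsILO.mul {P : Matrix ι κ ℂ} {Q : Matrix κ μ ℂ} (hP : IsILO P) (hQ : IsILO Q) :
    IsILO (P * Q) := by
  obtain ⟨R, h1, h2⟩ := hP
  obtain ⟨S, h3, h4⟩ := hQ
  refine ⟨S * R, ?_, ?_⟩
  · rw [Matrix.mul_assoc, ← Matrix.mul_assoc Q, h3, Matrix.one_mul, h1]
  · rw [Matrix.mul_assoc, ← Matrix.mul_assoc R, h2, Matrix.one_mul, h4]

theorem isILO_iff_isUnit {P : Matrix ι ι ℂ} : IsILO P ↔ IsUnit P := by
  constructor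
  · rintro ⟨R, h1, h2⟩
    exact ⟨⟨P, R, h1, h2⟩, rfl⟩
  · rintro ⟨u, rfl⟩
    exact ⟨↑u⁻¹, by simp, by simp⟩

theorem IsILO.card_eq {P : Matrix ι κ ℂ} (hP : IsILO P) : Fintype.card ι = Fintype.card κ := by
  obtain ⟨R, h1, h2⟩ := hP
  have := Matrix.square_of_invertible P R h1 h2
  exact this

theorem IsILO.fromBlocks {P : Matrix ι κ ℂ} {Q : Matrix μ ν ℂ} (hP : IsILO P) (hQ : IsILO Q) :
    IsILO (Matrix.fromBlocks P 0 0 Q) := by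
  obtain ⟨R, h1, h2⟩ := hP
  obtain ⟨S, h3, h4⟩ := hQ
  refine ⟨Matrix.fromBlocks R 0 0 S, ?_, ?_⟩ <;>
    simp [Matrix.fromBlocks_multiply, h1, h2, h3, h4]

theorem isILO_submatrix_one (e : ι ≃ κ) :
    IsILO ((1 : Matrix κ κ ℂ).submatrix e id) := by
  refine ⟨(1 : Matrix κ κ ℂ).submatrix id e, ?_, ?_⟩
  · rw [← Matrix.submatrix_mul _ _ _ id _ Function.bijective_id]
    simp
  · rw [← Matrix.submatrix_mul _ _ _ e _ e.bijective]
    simp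

theorem PQEquiv.refl (Γ : Fin L → Matrix ι ι ℂ) : PQEquiv Γ Γ :=
  ⟨1, 1, IsILO.one, IsILO.one, by simp⟩

theorem PQEquiv.symm {Γ : Fin L → Matrix ι ι ℂ} {Γ' : Fin L → Matrix κ κ ℂ}
    (h : PQEquiv Γ Γ') : PQEquiv Γ' Γ := by
  obtain ⟨P, Q, ⟨R, h1, h2⟩, ⟨S, h3, h4⟩, h⟩ := h
  refine ⟨R, S, ⟨P, h2, h1⟩, ⟨Q, h4, h3⟩, fun j => ?_⟩
  rw [← h j, ← Matrix.mul_assoc, ← Matrix.mul_assoc, h2, Matrix.one_mul, Matrix.mul_assoc, h3,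
    Matrix.mul_one]

theorem PQEquiv.trans {Γ : Fin L → Matrix ι ι ℂ} {Γ' : Fin L → Matrix κ κ ℂ}
    {Γ'' : Fin L → Matrix μ μ ℂ} (h : PQEquiv Γ Γ') (h' : PQEquiv Γ' Γ'') : PQEquiv Γ Γ'' := by
  obtain ⟨P, Q, hP, hQ, h⟩ := h
  obtain ⟨P', Q', hP', hQ', h'⟩ := h'
  refine ⟨P' * P, Q * Q', hP'.mul hP, hQ.mul hQ', fun j => ?_⟩
  rw [← h' j, ← h j]
  simp only [Matrix.mul_assoc]

theorem PQEquiv.card_eq {Γ : Fin L → Matrix ι ι ℂ} {Γ' : Fin L → Matrix κ κ ℂ}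
    (h : PQEquiv Γ Γ') : Fintype.card ι = Fintype.card κ := by
  obtain ⟨P, Q, hP, hQ, h⟩ := h
  exact hP.card_eq.symm

theorem pqEquiv_submatrix (Γ : Fin L → Matrix κ κ ℂ) (e : ι ≃ κ) :
    PQEquiv Γ (fun j => (Γ j).submatrix e e) := by
  refine ⟨(1 : Matrix κ κ ℂ).submatrix e id, (1 : Matrix κ κ ℂ).submatrix id e,
    isILO_submatrix_one e, ?_, fun j => ?_⟩
  · obtain ⟨R, h1, h2⟩ := isILO_submatrix_one e.symm
    refine ⟨(1 : Matrix κ κ ℂ).submatrix e id, ?_, ?_⟩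
    · rw [← Matrix.submatrix_mul _ _ _ e _ e.bijective]
      simp
    · rw [← Matrix.submatrix_mul _ _ _ id _ Function.bijective_id]
      simp
  · have h1 : Γ j = (Γ j).submatrix id id := by simp
    conv_lhs => rw [h1]
    rw [← Matrix.submatrix_mul _ _ _ id _ Function.bijective_id,
      ← Matrix.submatrix_mul _ _ _ id _ Function.bijective_id]
    simp

theorem PQEquiv.tupleSum {Γ : Fin L → Matrix ι ι ℂ} {Γ' : Fin L → Matrix κ κ ℂ}
    {B : Fin L → Matrix μ μ ℂ} {B' : Fin L → Matrix ν ν ℂ} (h : PQEquiv Γ Γ')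
    (h' : PQEquiv B B') : PQEquiv (tupleSum Γ B) (tupleSum Γ' B') := by
  obtain ⟨P, Q, hP, hQ, h⟩ := h
  obtain ⟨P', Q', hP', hQ', h'⟩ := h'
  refine ⟨_, _, hP.fromBlocks hP', hQ.fromBlocks hQ', fun j => ?_⟩
  simp [_root_.tupleSum, Matrix.fromBlocks_multiply, h, h']

theorem tupleSum_assoc (Γ : Fin L → Matrix ι ι ℂ) (B : Fin L → Matrix μ μ ℂ)
    (D : Fin L → Matrix ν ν ℂ) :
    PQEquiv (tupleSum Γ (tupleSum B D)) (tupleSum (tupleSum Γ B) D) := by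
  convert pqEquiv_submatrix (tupleSum Γ (tupleSum B D)) (Equiv.sumAssoc ι μ ν) using 1
  funext j
  ext u v
  rcases u with (u | u) | u <;> rcases v with (v | v) | v <;> rfl

/-- The linear combination of the matrices of a tuple with given coefficients. -/
noncomputable def linComb (t : Fin L → ℂ) (Γ : Fin L → Matrix ι ι ℂ) : Matrix ι ι ℂ :=
  ∑ j, t j • Γ j

theorem applyT_eq_linComb (T : Matrix (Fin L) (Fin L) ℂ) (Γ : Fin L → Matrix ι ι ℂ) (i : Fin L) :
    applyT T Γ i = linComb (T i) Γ := rfl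

theorem linComb_add (s t : Fin L → ℂ) (Γ : Fin L → Matrix ι ι ℂ) :
    linComb (s + t) Γ = linComb s Γ + linComb t Γ := by
  simp [linComb, add_smul, Finset.sum_add_distrib]

theorem linComb_smul (z : ℂ) (t : Fin L → ℂ) (Γ : Fin L → Matrix ι ι ℂ) :
    linComb (z • t) Γ = z • linComb t Γ := by
  simp [linComb, Finset.smul_sum, smul_smul]

theorem linComb_single (i : Fin L) (Γ : Fin L → Matrix ι ι ℂ) :
    linComb (Pi.single i 1) Γ = Γ i := by
  unfold linComb
  rw [Finset.sum_eq_single i (by intro j _ hj; simp [hj]) (by simp)]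
  simp

theorem mul_linComb_mul (P : Matrix κ ι ℂ) (Q : Matrix ι κ ℂ) (t : Fin L → ℂ)
    (Γ : Fin L → Matrix ι ι ℂ) :
    P * linComb t Γ * Q = linComb t (fun j => P * Γ j * Q) := by
  simp [linComb, Matrix.mul_sum, Matrix.sum_mul]

theorem linComb_tupleSum (t : Fin L → ℂ) (Γ : Fin L → Matrix ι ι ℂ) (B : Fin L → Matrix κ κ ℂ) :
    linComb t (tupleSum Γ B) = Matrix.fromBlocks (linComb t Γ) 0 0 (linComb t B) := by
  ext u v
  rcases u with u | u <;> rcases v with v | v <;>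
    simp [linComb, tupleSum, Matrix.sum_apply]

theorem linComb_applyT (t : Fin L → ℂ) (T : Matrix (Fin L) (Fin L) ℂ)
    (Γ : Fin L → Matrix ι ι ℂ) : linComb t (applyT T Γ) = linComb (Matrix.vecMul t T) Γ := by
  simp only [linComb, applyT, Matrix.vecMul, dotProduct, Finset.smul_sum, smul_smul,
    Finset.sum_smul]
  exact Finset.sum_comm

theorem applyT_applyT (S T : Matrix (Fin L) (Fin L) ℂ) (Γ : Fin L → Matrix ι ι ℂ) :
    applyT S (applyT T Γ) = applyT (S * T) Γ := by
  funext i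
  rw [applyT_eq_linComb, linComb_applyT]
  rfl

theorem applyT_one (Γ : Fin L → Matrix ι ι ℂ) : applyT 1 Γ = Γ := by
  funext i
  rw [applyT_eq_linComb]
  convert linComb_single i Γ using 2
  ext j
  simp [Matrix.one_apply, Pi.single_apply, eq_comm]

theorem applyT_tupleSum (T : Matrix (Fin L) (Fin L) ℂ) (Γ : Fin L → Matrix ι ι ℂ)
    (B : Fin L → Matrix κ κ ℂ) :
    applyT T (tupleSum Γ B) = tupleSum (applyT T Γ) (applyT T B) := by
  funext i
  exact linComb_tupleSum (T i) Γ B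

theorem PQEquiv.applyT {Γ : Fin L → Matrix ι ι ℂ} {Γ' : Fin L → Matrix κ κ ℂ}
    (h : PQEquiv Γ Γ') (T : Matrix (Fin L) (Fin L) ℂ) :
    PQEquiv (applyT T Γ) (applyT T Γ') := by
  obtain ⟨P, Q, hP, hQ, h⟩ := h
  refine ⟨P, Q, hP, hQ, fun j => ?_⟩
  rw [applyT_eq_linComb, applyT_eq_linComb, mul_linComb_mul]
  simp [h]

/-- The action on the first party commutes with that on the other two, so the two stages can be
treated separately. -/
theorem sloccEquiv_iff {Γ : Fin L → Matrix ι ι ℂ} {Γ' : Fin L → Matrix κ κ ℂ} :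
    SLOCCEquiv Γ Γ' ↔ ∃ T : Matrix (Fin L) (Fin L) ℂ, IsILO T ∧ PQEquiv (applyT T Γ) Γ' := by
  have key : ∀ (T : Matrix (Fin L) (Fin L) ℂ) (P : Matrix κ ι ℂ) (Q : Matrix ι κ ℂ) (i : Fin L),
      P * applyT T Γ i * Q = ∑ j, T i j • (P * Γ j * Q) := by
    intro T P Q i
    rw [applyT_eq_linComb, mul_linComb_mul]
    rfl
  constructor
  · rintro ⟨T, P, Q, hT, hP, hQ, h⟩
    exact ⟨T, hT, P, Q, hP, hQ, fun i => by rw [key, h]⟩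
  · rintro ⟨T, hT, P, Q, hP, hQ, h⟩
    exact ⟨T, P, Q, hT, hP, hQ, fun i => by rw [← key, h]⟩

theorem PQEquiv.of_applyT {S T : Matrix (Fin L) (Fin L) ℂ} {Γ : Fin L → Matrix ι ι ℂ}
    {Γ' : Fin L → Matrix κ κ ℂ} (hST : S * T = 1) (h : PQEquiv (_root_.applyT T Γ) Γ') :
    PQEquiv Γ (_root_.applyT S Γ') := by
  have := h.applyT S
  rwa [applyT_applyT, hST, applyT_one] at this

theorem SLOCCEquiv.of_pqEquiv {Γ : Fin L → Matrix ι ι ℂ} {Γ' : Fin L → Matrix κ κ ℂ}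
    (h : PQEquiv Γ Γ') : SLOCCEquiv Γ Γ' :=
  sloccEquiv_iff.2 ⟨1, IsILO.one, by rwa [applyT_one]⟩

theorem sloccEquiv_applyT {T : Matrix (Fin L) (Fin L) ℂ} (hT : IsILO T)
    (Γ : Fin L → Matrix ι ι ℂ) : SLOCCEquiv Γ (applyT T Γ) :=
  sloccEquiv_iff.2 ⟨T, hT, PQEquiv.refl _⟩

theorem SLOCCEquiv.symm {Γ : Fin L → Matrix ι ι ℂ} {Γ' : Fin L → Matrix κ κ ℂ}
    (h : SLOCCEquiv Γ Γ') : SLOCCEquiv Γ' Γ := by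
  obtain ⟨T, ⟨S, h1, h2⟩, h⟩ := sloccEquiv_iff.1 h
  exact sloccEquiv_iff.2 ⟨S, ⟨T, h2, h1⟩, (h.of_applyT h2).symm⟩

theorem SLOCCEquiv.trans {Γ : Fin L → Matrix ι ι ℂ} {Γ' : Fin L → Matrix κ κ ℂ}
    {Γ'' : Fin L → Matrix μ μ ℂ} (h : SLOCCEquiv Γ Γ') (h' : SLOCCEquiv Γ' Γ'') :
    SLOCCEquiv Γ Γ'' := by
  obtain ⟨T, hT, h⟩ := sloccEquiv_iff.1 h
  obtain ⟨S, hS, h'⟩ := sloccEquiv_iff.1 h'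
  refine sloccEquiv_iff.2 ⟨S * T, hS.mul hT, ?_⟩
  rw [← applyT_applyT]
  exact (h.applyT S).trans h'

theorem SimSimilar.symm {γ : Fin l → Matrix ι ι ℂ} {γ' : Fin l → Matrix κ κ ℂ}
    (h : SimSimilar γ γ') : SimSimilar γ' γ := by
  obtain ⟨P, R, h1, h2, h⟩ := h
  refine ⟨R, P, h2, h1, fun j => ?_⟩
  rw [← h j, ← Matrix.mul_assoc, ← Matrix.mul_assoc, h2, Matrix.one_mul, Matrix.mul_assoc, h2,
    Matrix.mul_one]

theorem SimSimilar.trans {γ : Fin l → Matrix ι ι ℂ} {γ' : Fin l → Matrix κ κ ℂ}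
    {γ'' : Fin l → Matrix μ μ ℂ} (h : SimSimilar γ γ') (h' : SimSimilar γ' γ'') :
    SimSimilar γ γ'' := by
  obtain ⟨P, R, h1, h2, h⟩ := h
  obtain ⟨P', R', h1', h2', h'⟩ := h'
  refine ⟨P' * P, R * R', ?_, ?_, fun j => ?_⟩
  · rw [Matrix.mul_assoc, ← Matrix.mul_assoc P, h1, Matrix.one_mul, h1']
  · rw [Matrix.mul_assoc, ← Matrix.mul_assoc R', h2', Matrix.one_mul, h2]
  · rw [← h' j, ← h j]
    simp only [Matrix.mul_assoc]

theorem simSimilar_of_intertwine {γ : Fin l → Matrix ι ι ℂ} {γ' : Fin l → Matrix κ κ ℂ}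
    {P : Matrix κ ι ℂ} {R : Matrix ι κ ℂ} (h1 : P * R = 1) (h2 : R * P = 1)
    (h : ∀ j, P * γ j = γ' j * P) : SimSimilar γ γ' :=
  ⟨P, R, h1, h2, fun j => by rw [h, Matrix.mul_assoc, h1, Matrix.mul_one]⟩

theorem SimSimilar.exists_intertwine {γ : Fin l → Matrix ι ι ℂ} {γ' : Fin l → Matrix κ κ ℂ}
    (h : SimSimilar γ γ') : ∃ (P : Matrix κ ι ℂ) (R : Matrix ι κ ℂ), P * R = 1 ∧ R * P = 1 ∧
      (∀ j, P * γ j = γ' j * P) ∧ ∀ j, R * γ' j = γ j * R := by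
  obtain ⟨P, R, h1, h2, h⟩ := h
  refine ⟨P, R, h1, h2, fun j => ?_, fun j => ?_⟩
  · rw [← h j, Matrix.mul_assoc, h2, Matrix.mul_one]
  · rw [← h j, ← Matrix.mul_assoc, ← Matrix.mul_assoc, h2, Matrix.one_mul]

/-- Comparing first matrices gives PQ = E, which forces Q to be the inverse of P. -/
theorem pqEquiv_consTuple_one_iff {γ : Fin l → Matrix ι ι ℂ} {γ' : Fin l → Matrix κ κ ℂ} :
    PQEquiv (consTuple 1 γ) (consTuple 1 γ') ↔ SimSimilar γ γ' := by
  constructor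
  · rintro ⟨P, Q, ⟨R, h1, h2⟩, ⟨S, h3, h4⟩, h⟩
    have h0 : P * Q = 1 := by simpa [consTuple] using h 0
    have hQ : Q = R := by
      calc Q = (R * P) * Q := by rw [h2, Matrix.one_mul]
        _ = R := by rw [Matrix.mul_assoc, h0, Matrix.mul_one]
    exact ⟨P, Q, h0, hQ ▸ h2, fun j => by simpa [consTuple] using h j.succ⟩
  · rintro ⟨P, R, h1, h2, h⟩
    refine ⟨P, R, ⟨R, h1, h2⟩, ⟨P, h2, h1⟩, fun j => ?_⟩
    refine Fin.cases ?_ (fun j => ?_) j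
    · simpa [consTuple] using h1
    · simpa [consTuple] using h j

theorem pqEquiv_consTuple_one_of_isUnit {Γ : Fin (l + 1) → Matrix ι ι ℂ} (h : IsUnit (Γ 0)) :
    PQEquiv Γ (consTuple 1 fun j => (Γ 0)⁻¹ * Γ j.succ) := by
  have hdet := (Matrix.isUnit_iff_isUnit_det _).1 h
  refine ⟨(Γ 0)⁻¹, 1, ⟨Γ 0, Matrix.nonsing_inv_mul _ hdet, Matrix.mul_nonsing_inv _ hdet⟩,
    IsILO.one, fun j => ?_⟩
  refine Fin.cases ?_ (fun j => ?_) j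
  · simp [consTuple, Matrix.nonsing_inv_mul _ hdet]
  · simp [consTuple]

theorem pqEquiv_renormalize {T : Matrix (Fin (l + 1)) (Fin (l + 1)) ℂ}
    {γ : Fin l → Matrix ι ι ℂ} (h : IsUnit (applyT T (consTuple 1 γ) 0)) :
    PQEquiv (applyT T (consTuple 1 γ)) (consTuple 1 (renormalize T γ)) :=
  pqEquiv_consTuple_one_of_isUnit h

theorem IsILO.rank_mul_mul {P : Matrix κ ι ℂ} {Q : Matrix ι κ ℂ} (hP : IsILO P) (hQ : IsILO Q)
    (M : Matrix ι ι ℂ) : (P * M * Q).rank = M.rank := by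
  obtain ⟨R, h1, h2⟩ := hP
  obtain ⟨S, h3, h4⟩ := hQ
  apply le_antisymm
  · exact (Matrix.rank_mul_le_left _ _).trans (Matrix.rank_mul_le_right _ _)
  · have : M = R * (P * M * Q) * S := by
      rw [Matrix.mul_assoc, Matrix.mul_assoc _ Q S, h3, ← Matrix.mul_assoc, ← Matrix.mul_assoc, h2,
        Matrix.one_mul, Matrix.mul_one]
    conv_lhs => rw [this]
    exact (Matrix.rank_mul_le_left _ _).trans (Matrix.rank_mul_le_right _ _)

theorem PQEquiv.rank_linComb {Γ : Fin L → Matrix ι ι ℂ} {Γ' : Fin L → Matrix κ κ ℂ}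
    (h : PQEquiv Γ Γ') (t : Fin L → ℂ) : (linComb t Γ').rank = (linComb t Γ).rank := by
  obtain ⟨P, Q, hP, hQ, h⟩ := h
  rw [← hP.rank_mul_mul hQ (linComb t Γ), mul_linComb_mul]
  simp [h]

/-- Both blocks can be made diagonal by invertible factors; then nonzero diagonal entries are
counted. -/
theorem rank_fromBlocks_diagonal (A : Matrix ι ι ℂ) (D : Matrix κ κ ℂ) :
    (Matrix.fromBlocks A 0 0 D).rank = A.rank + D.rank := by
  have key : ∀ {α : Type} [Fintype α] [DecidableEq α] (M : Matrix α α ℂ),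
      ∃ (P Q : Matrix α α ℂ) (w : α → ℂ), IsILO P ∧ IsILO Q ∧ P * M * Q = Matrix.diagonal w := by
    intro α _ _ M
    obtain ⟨V, U, e, hV, hU, h⟩ := M.exists_rank_normal_form
    refine ⟨V, U, Sum.elim (fun _ => 1) (fun _ => 0) ∘ e, isILO_iff_isUnit.2 hV,
      isILO_iff_isUnit.2 hU, ?_⟩
    rw [h, ← Matrix.diagonal_one, ← Matrix.diagonal_zero, Matrix.fromBlocks_diagonal,
      Matrix.submatrix_diagonal_equiv]
  obtain ⟨P, Q, w, hP, hQ, h⟩ := key A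
  obtain ⟨P', Q', w', hP', hQ', h'⟩ := key D
  rw [← (hP.fromBlocks hP').rank_mul_mul (hQ.fromBlocks hQ'), ← hP.rank_mul_mul hQ A,
    ← hP'.rank_mul_mul hQ' D]
  simp only [Matrix.fromBlocks_multiply, Matrix.zero_mul, Matrix.mul_zero, add_zero, zero_add,
    h, h', Matrix.fromBlocks_diagonal, Matrix.rank_diagonal]
  rw [Fintype.card_congr (Equiv.subtypeSum), Fintype.card_sum]
  rfl

end Basics

/-! ### Generic rank of linear combinations -/

section MaxRank

open Filter

variable {ι κ : Type} [Fintype ι] [DecidableEq ι] [Fintype κ] [DecidableEq κ] {L l : ℕ}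

/-- The determinant is a polynomial in z with value 1 at z = 0, hence not the zero polynomial. -/
theorem finite_setOf_det_one_add_smul_eq_zero (K : Matrix ι ι ℂ) :
    {z : ℂ | (1 + z • K).det = 0}.Finite := by
  let p : Polynomial ℂ := (1 + (Polynomial.X : Polynomial ℂ) • K.map Polynomial.C).det
  have hp : ∀ z, p.eval z = (1 + z • K).det := by
    intro z
    rw [← Polynomial.coe_evalRingHom, RingHom.map_det]
    congr 1
    ext i j
    simp [Matrix.one_apply, apply_ite (Polynomial.eval z)]
    exact mul_comm _ _
  have hp0 : p ≠ 0 := by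
    intro h
    have := hp 0
    simp [h] at this
  refine (Polynomial.finite_setOfPred_isRoot hp0).subset fun z hz => ?_
  rw [Set.mem_ofPred_eq, Polynomial.IsRoot.def, hp]
  exact hz

/-- Lower semicontinuity of the rank: the normal form of M provides a compression to size rank M
that sends M to 1, and the compression of M + zM' is invertible for all but finitely many z. -/
theorem eventually_rank_le_rank_add_smul (M M' : Matrix ι ι ℂ) :
    ∀ᶠ z : ℂ in cofinite, M.rank ≤ (M + z • M').rank := by
  obtain ⟨V, U, e, hV, hU, h⟩ := M.exists_rank_normal_form
  let f : Fin M.rank → ι := e.symm ∘ Sum.inl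
  have key : ∀ N : Matrix ι ι ℂ,
      V.submatrix f id * N * U.submatrix id f = (V * N * U).submatrix f f := by
    intro N
    have h1 : N = N.submatrix id id := by simp
    conv_lhs => rw [h1]
    rw [← Matrix.submatrix_mul _ _ _ id _ Function.bijective_id,
      ← Matrix.submatrix_mul _ _ _ id _ Function.bijective_id]
  have hM : (V * M * U).submatrix f f = 1 := by
    rw [h]
    ext i j
    simp [f, Matrix.one_apply]
  have hfin := finite_setOf_det_one_add_smul_eq_zero ((V * M' * U).submatrix f f)
  have hev : ∀ᶠ z : ℂ in cofinite, (1 + z • (V * M' * U).submatrix f f).det ≠ 0 := by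
    rw [eventually_cofinite]
    simpa using hfin
  filter_upwards [hev] with z hz
  have h2 : V.submatrix f id * (M + z • M') * U.submatrix id f =
      1 + z • (V * M' * U).submatrix f f := by
    rw [key, Matrix.mul_add, Matrix.add_mul, Matrix.submatrix_add, Pi.add_apply, Pi.add_apply, hM,
      Matrix.mul_smul, Matrix.smul_mul]
    rfl
  have h3 := Matrix.rank_of_det_ne_zero hz
  rw [← h2, Fintype.card_fin] at h3
  rw [← h3]
  exact (Matrix.rank_mul_le_left _ _).trans (Matrix.rank_mul_le_right _ _)

theorem rank_smul_of_ne_zero {z : ℂ} (hz : z ≠ 0) (M : Matrix ι ι ℂ) :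
    (z • M).rank = M.rank :=
  Matrix.rank_smul_of_mem_nonZeroDivisors M (mem_nonZeroDivisors_of_ne_zero hz)

/-- Up to the nonzero factor z, M + zM' equals M' + z⁻¹M, so the roles of M and M' are exchanged by
inversion. -/
theorem eventually_rank_le_rank_add_smul' (M M' : Matrix ι ι ℂ) :
    ∀ᶠ z : ℂ in cofinite, M'.rank ≤ (M + z • M').rank := by
  have h1 := (inv_injective (G := ℂ)).tendsto_cofinite.eventually
    (eventually_rank_le_rank_add_smul M' M)
  have h2 : ∀ᶠ z : ℂ in cofinite, z ≠ 0 := by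
    rw [eventually_cofinite]
    simp
  filter_upwards [h1, h2] with z hz hz0
  refine hz.trans_eq ?_
  rw [← rank_smul_of_ne_zero hz0, smul_add, smul_smul, mul_inv_cancel₀ hz0, one_smul, add_comm]

/-- A generic point s + zt of the line through s in direction t serves both inequalities at once. -/
theorem exists_rank_linComb_ge (U : Fin L → Matrix ι ι ℂ) (D : Fin L → Matrix κ κ ℂ)
    (s t : Fin L → ℂ) : ∃ u : Fin L → ℂ, (linComb s U).rank ≤ (linComb u U).rank ∧
      (linComb t D).rank ≤ (linComb u D).rank := by
  obtain ⟨z, h1, h2⟩ := ((eventually_rank_le_rank_add_smul (linComb s U) (linComb t U)).and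
    (eventually_rank_le_rank_add_smul' (linComb s D) (linComb t D))).exists
  refine ⟨s + z • t, ?_, ?_⟩
  · rwa [linComb_add, linComb_smul]
  · rwa [linComb_add, linComb_smul]

theorem firstHasMaxRank_iff {Γ : Fin (l + 1) → Matrix ι ι ℂ} :
    FirstHasMaxRank Γ ↔ ∀ t, (linComb t Γ).rank ≤ (Γ 0).rank := Iff.rfl

theorem FirstHasMaxRank.of_pqEquiv {Γ : Fin (l + 1) → Matrix ι ι ℂ}
    {Γ' : Fin (l + 1) → Matrix κ κ ℂ} (h : FirstHasMaxRank Γ) (h' : PQEquiv Γ Γ') :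
    FirstHasMaxRank Γ' := by
  intro t
  have h0 := h'.rank_linComb (Pi.single 0 1)
  rw [linComb_single, linComb_single] at h0
  rw [h0]
  exact (h'.rank_linComb t).trans_le (h t)

/-- Ranks add over the sum. A combination that raised the rank in one summand could be chosen
without loss in the other, and would then raise the total. -/
theorem FirstHasMaxRank.tupleSum {U : Fin (l + 1) → Matrix ι ι ℂ}
    {D : Fin (l + 1) → Matrix κ κ ℂ} (h : FirstHasMaxRank (tupleSum U D)) :
    FirstHasMaxRank U ∧ FirstHasMaxRank D := by
  have key : ∀ u, (linComb u U).rank + (linComb u D).rank ≤ (U 0).rank + (D 0).rank := by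
    intro u
    have := firstHasMaxRank_iff.1 h u
    rwa [linComb_tupleSum, _root_.tupleSum, rank_fromBlocks_diagonal,
      rank_fromBlocks_diagonal] at this
  constructor
  · intro t
    obtain ⟨u, h1, h2⟩ := exists_rank_linComb_ge U D t (Pi.single 0 1)
    rw [linComb_single] at h2
    have := key u
    change (linComb t U).rank ≤ _
    omega
  · intro t
    obtain ⟨u, h1, h2⟩ := exists_rank_linComb_ge U D (Pi.single 0 1) t
    rw [linComb_single] at h1
    have := key u
    change (linComb t D).rank ≤ _
    omega

theorem exists_isILO_firstHasMaxRank (Γ : Fin (l + 1) → Matrix ι ι ℂ) :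
    ∃ T : Matrix (Fin (l + 1)) (Fin (l + 1)) ℂ, IsILO T ∧ FirstHasMaxRank (applyT T Γ) := by
  obtain ⟨t, ht⟩ : ∃ t : Fin (l + 1) → ℂ, ∀ s, (linComb s Γ).rank ≤ (linComb t Γ).rank := by
    have hfin : (Set.range fun t : Fin (l + 1) → ℂ => (linComb t Γ).rank).Finite :=
      (Set.finite_Iic (Fintype.card ι)).subset (by
        rintro _ ⟨t, rfl⟩
        exact Matrix.rank_le_card_width _)
    obtain ⟨_, ⟨t, rfl⟩, ht⟩ := hfin.exists_maximal ⟨_, 0, rfl⟩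
    refine ⟨t, fun s => ?_⟩
    rcases le_total (linComb s Γ).rank (linComb t Γ).rank with h | h
    · exact h
    · exact ht ⟨s, rfl⟩ h
  -- T is taken as 1 + z e₀tᵀ, whose first row is e₀ + zt: a generic z makes T invertible and lets
  -- this row attain the maximum rank found at t.
  have hdet := finite_setOf_det_one_add_smul_eq_zero
    (Matrix.vecMulVec (Pi.single 0 1) t : Matrix (Fin (l + 1)) (Fin (l + 1)) ℂ)
  have hev : ∀ᶠ z : ℂ in cofinite,
      (1 + z • (Matrix.vecMulVec (Pi.single 0 1) t :
        Matrix (Fin (l + 1)) (Fin (l + 1)) ℂ)).det ≠ 0 := by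
    rw [eventually_cofinite]
    simpa using hdet
  obtain ⟨z, h1, h2⟩ := (hev.and
    (eventually_rank_le_rank_add_smul' (linComb (Pi.single 0 1) Γ) (linComb t Γ))).exists
  refine ⟨_, isILO_iff_isUnit.2 ((Matrix.isUnit_iff_isUnit_det _).2 (isUnit_iff_ne_zero.2 h1)),
    firstHasMaxRank_iff.2 fun s => ?_⟩
  rw [linComb_applyT]
  refine (ht _).trans (h2.trans_eq ?_)
  rw [applyT_eq_linComb, ← linComb_smul, ← linComb_add]
  congr 2
  ext j
  simp [Matrix.vecMulVec_apply, Matrix.one_apply, Pi.single_apply, eq_comm]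

theorem rank_lambdaPrime {m i : ℕ} : (lambdaPrime m i).rank = m - i := by
  rw [lambdaPrime, Matrix.rank_diagonal, Fintype.card_subtype]
  have h : (Finset.univ.filter fun k : Fin m => (if (k : ℕ) < m - i then (1 : ℂ) else 0) ≠ 0) =
      Finset.univ.filter fun k : Fin m => (k : ℕ) < m - i := by
    ext k
    simp only [Finset.mem_filter, ite_ne_right_iff, ne_eq, one_ne_zero, not_false_eq_true,
      and_true]
  rw [h, Fin.card_filter_val_lt]
  omega

theorem lambdaPrime_zero (m : ℕ) : lambdaPrime m 0 = 1 := by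
  rw [lambdaPrime, ← Matrix.diagonal_one]
  congr 1
  funext k
  simp [k.isLt]

theorem exists_pqEquiv_lambdaPrime {m : ℕ} (D : Fin (l + 1) → Matrix (Fin m) (Fin m) ℂ) :
    ∃ β : Fin l → Matrix (Fin m) (Fin m) ℂ,
      PQEquiv D (consTuple (lambdaPrime m (m - (D 0).rank)) β) := by
  obtain ⟨V, U, e, hV, hU, h⟩ := (D 0).exists_rank_normal_form
  have hr : (D 0).rank ≤ m := by simpa using Matrix.rank_le_card_width (D 0)
  have hm : (D 0).rank + (Fintype.card (Fin m) - (D 0).rank) = m := by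
    rw [Fintype.card_fin]
    omega
  -- The ones of the normal form sit on the left summand; π numbers these positions first, as in Λ'.
  let π : Fin m ≃ Fin m := (e.trans finSumFinEquiv).trans (finCongr hm)
  have h1 : PQEquiv D (fun j => V * D j * U) :=
    ⟨V, U, isILO_iff_isUnit.2 hV, isILO_iff_isUnit.2 hU, fun _ => rfl⟩
  refine ⟨fun j => (V * D j.succ * U).submatrix π.symm π.symm, ?_⟩
  convert h1.trans (pqEquiv_submatrix _ π.symm) using 1
  funext j
  refine Fin.cases ?_ (fun j => rfl) j
  rw [h, ← Matrix.diagonal_one, ← Matrix.diagonal_zero, Matrix.fromBlocks_diagonal,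
    Matrix.submatrix_diagonal_equiv, Matrix.submatrix_diagonal_equiv]
  change lambdaPrime _ _ = _
  rw [lambdaPrime]
  congr 1
  funext k
  obtain ⟨k, rfl⟩ := π.surjective k
  rw [Function.comp_apply, Equiv.symm_apply_apply, Function.comp_apply]
  have : m - (m - (D 0).rank) = (D 0).rank := by omega
  rw [this]
  rcases hk : e k with a | a
  · have : (π k : ℕ) = a := by simp [π, hk]
    simp [this]
  · have : (π k : ℕ) = (D 0).rank + a := by simp [π, hk]
    simp [this]

end MaxRank

/-! ### Splitting idempotents and cancelling identity summands -/

section Cancellation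

open Matrix

variable {ι : Type} [Fintype ι] [DecidableEq ι] {L l : ℕ}

theorem Matrix.exists_rank_factorization (M : Matrix ι ι ℂ) :
    ∃ (w : ℕ) (a b' : Matrix ι (Fin w) ℂ) (a' b : Matrix (Fin w) ι ℂ),
      M = a * b ∧ a' * a = 1 ∧ b * b' = 1 := by
  obtain ⟨V, U, e, hV, hU, h⟩ := M.exists_rank_normal_form
  obtain ⟨V', hV1, hV2⟩ := isILO_iff_isUnit.2 hV
  obtain ⟨U', hU1, hU2⟩ := isILO_iff_isUnit.2 hU
  let a₀ : Matrix ι (Fin M.rank) ℂ := (1 : Matrix ι ι ℂ).submatrix id (e.symm ∘ Sum.inl)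
  let b₀ : Matrix (Fin M.rank) ι ℂ := (1 : Matrix ι ι ℂ).submatrix (e.symm ∘ Sum.inl) id
  have hab : b₀ * a₀ = 1 := by
    ext i j
    simp [a₀, b₀, Matrix.mul_apply, Matrix.one_apply]
  have hba : a₀ * b₀ = (fromBlocks 1 0 0 0).submatrix e e := by
    ext i j
    obtain ⟨i, rfl⟩ := e.symm.surjective i
    obtain ⟨j, rfl⟩ := e.symm.surjective j
    rcases i with i | i <;> rcases j with j | j <;>
      simp [a₀, b₀, Matrix.mul_apply, Matrix.one_apply]
  refine ⟨_, V' * a₀, U * a₀, b₀ * V, b₀ * U', ?_, ?_, ?_⟩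
  · calc M = (V' * V) * M * (U * U') := by rw [hV2, hU1, Matrix.one_mul, Matrix.mul_one]
      _ = V' * (V * M * U) * U' := by simp only [Matrix.mul_assoc]
      _ = _ := by rw [h, ← hba]; simp only [Matrix.mul_assoc]
  · rw [Matrix.mul_assoc, ← Matrix.mul_assoc V, hV1, Matrix.one_mul, hab]
  · rw [Matrix.mul_assoc, ← Matrix.mul_assoc U', hU2, Matrix.one_mul, hab]

/-- In a full-rank factorization e = ab the relation a(ba)b = ab can be cancelled on both sides. -/
theorem Matrix.exists_split_of_idempotent {e : Matrix ι ι ℂ} (he : e * e = e) :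
    ∃ (w : ℕ) (a : Matrix ι (Fin w) ℂ) (b : Matrix (Fin w) ι ℂ), e = a * b ∧ b * a = 1 := by
  obtain ⟨w, a, b', a', b, h, ha, hb⟩ := e.exists_rank_factorization
  refine ⟨w, a, b, h, ?_⟩
  calc b * a = (a' * a) * (b * a) * (b * b') := by rw [ha, hb, Matrix.one_mul, Matrix.mul_one]
    _ = a' * ((a * b) * (a * b)) * b' := by simp only [Matrix.mul_assoc]
    _ = (a' * a) * (b * b') := by rw [← h, he, h]; simp only [Matrix.mul_assoc]
    _ = 1 := by rw [ha, hb, Matrix.one_mul]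

/-- The pair (k, r) comes from splitting the complementary idempotent 1 − st. -/
theorem Matrix.exists_complement {w : ℕ} {t : Matrix (Fin w) ι ℂ} {s : Matrix ι (Fin w) ℂ}
    (h : t * s = 1) : ∃ (w' : ℕ) (k : Matrix ι (Fin w') ℂ) (r : Matrix (Fin w') ι ℂ),
      t * k = 0 ∧ r * s = 0 ∧ r * k = 1 ∧ s * t + k * r = 1 := by
  have he : (1 - s * t) * (1 - s * t) = 1 - s * t := by
    have : s * t * (s * t) = s * t := by
      rw [Matrix.mul_assoc, ← Matrix.mul_assoc t, h, Matrix.one_mul]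
    rw [Matrix.mul_sub, Matrix.sub_mul 1, Matrix.sub_mul 1, this]
    simp
  obtain ⟨w', k, r, hkr, hrk⟩ := exists_split_of_idempotent he
  refine ⟨w', k, r, ?_, ?_, hrk, by rw [← hkr]; simp⟩
  · calc t * k = t * (k * r) * k := by rw [Matrix.mul_assoc, Matrix.mul_assoc, hrk, Matrix.mul_one]
      _ = 0 := by rw [← hkr, Matrix.mul_sub, ← Matrix.mul_assoc, h]; simp
  · calc r * s = r * ((k * r) * s) := by
          rw [Matrix.mul_assoc, ← Matrix.mul_assoc, hrk, Matrix.one_mul]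
      _ = 0 := by rw [← hkr, Matrix.sub_mul, Matrix.mul_assoc s, h]; simp

theorem isILO_fromRows {w w' : ℕ} {t : Matrix (Fin w) ι ℂ} {s : Matrix ι (Fin w) ℂ}
    {k : Matrix ι (Fin w') ℂ} {r : Matrix (Fin w') ι ℂ} (h1 : t * s = 1) (h2 : t * k = 0)
    (h3 : r * s = 0) (h4 : r * k = 1) (h5 : s * t + k * r = 1) :
    IsILO (fromRows t r) ∧ IsILO (fromCols s k) := by
  have h : fromRows t r * fromCols s k = 1 := by
    rw [fromRows_mul_fromCols, h1, h2, h3, h4, fromBlocks_one]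
  have h' : fromCols s k * fromRows t r = 1 := by
    rw [fromCols_mul_fromRows, h5]
  exact ⟨⟨_, h, h'⟩, ⟨_, h', h⟩⟩

/-- A morphism of tuples is a pair of matrices, one for rows and one for columns. Here W → D → W
composes to the identity, so W is a direct summand; rows and columns get separate complements, of
equal size by counting. -/
theorem exists_pqEquiv_tupleSum_of_split {w m : ℕ} {W : Fin L → Matrix (Fin w) (Fin w) ℂ}
    {D : Fin L → Matrix (Fin m) (Fin m) ℂ} {s₁ s₂ : Matrix (Fin m) (Fin w) ℂ}
    {t₁ t₂ : Matrix (Fin w) (Fin m) ℂ} (h₁ : t₁ * s₁ = 1) (h₂ : t₂ * s₂ = 1)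
    (hs : ∀ j, D j * s₂ = s₁ * W j) (ht : ∀ j, t₁ * D j = W j * t₂) :
    ∃ (m' : ℕ) (D' : Fin L → Matrix (Fin m') (Fin m') ℂ), PQEquiv D (tupleSum W D') := by
  obtain ⟨w₁, k₁, r₁, ha, hb, hc, hd⟩ := exists_complement h₁
  obtain ⟨w₂, k₂, r₂, ha', hb', hc', hd'⟩ := exists_complement h₂
  obtain ⟨hP, -⟩ := isILO_fromRows h₁ ha hb hc hd
  obtain ⟨-, hQ⟩ := isILO_fromRows h₂ ha' hb' hc' hd'
  obtain rfl : w₁ = w₂ := by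
    have h3 := hP.card_eq
    have h4 := hQ.card_eq
    simp only [Fintype.card_sum, Fintype.card_fin] at h3 h4
    omega
  refine ⟨w₁, fun j => r₁ * D j * k₂, _, _, hP, hQ, fun j => ?_⟩
  rw [fromRows_mul, fromRows_mul_fromCols, tupleSum]
  congr 1
  · rw [ht, Matrix.mul_assoc, h₂, Matrix.mul_one]
  · rw [ht, Matrix.mul_assoc, ha', Matrix.mul_zero]
  · rw [Matrix.mul_assoc, hs, ← Matrix.mul_assoc, hb, Matrix.zero_mul]

/-- Fitting decomposition. Write the characteristic polynomial as X^k q with X ∤ q and take uX^(k+1)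
+ vq = 1. Then uX^(k+1) evaluated at b is the projection onto the invertible part, and c is uX^k at
b. If the projection vanished, (vq)(b) would be 1 and b^k = 0. -/
theorem Matrix.exists_idempotent_of_not_isNilpotent {b : Matrix ι ι ℂ} (hb : ¬ IsNilpotent b) :
    ∃ c : Matrix ι ι ℂ, (∀ M, Commute b M → Commute c M) ∧ (b * c) * (b * c) = b * c ∧
      b * c ≠ 0 := by
  obtain ⟨q, hq, hq'⟩ := Polynomial.exists_eq_pow_rootMultiplicity_mul_and_not_dvd b.charpoly
    b.charpoly_monic.ne_zero 0
  rw [Polynomial.C_0, sub_zero] at hq hq'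
  set k := b.charpoly.rootMultiplicity 0
  obtain ⟨u, v, huv⟩ : IsCoprime (Polynomial.X ^ (k + 1) : Polynomial ℂ) q :=
    IsCoprime.pow_left ((Polynomial.irreducible_X.coprime_iff_not_dvd).2 hq')
  have hzero : ∀ p : Polynomial ℂ, Polynomial.aeval b (p * (Polynomial.X ^ k * q)) = 0 := by
    intro p
    rw [← hq, map_mul, Matrix.aeval_self_charpoly, mul_zero]
  have hc : b * Polynomial.aeval b (u * Polynomial.X ^ k) =
      Polynomial.aeval b (u * Polynomial.X ^ (k + 1)) := by
    rw [pow_succ', mul_left_comm u, map_mul _ Polynomial.X, Polynomial.aeval_X]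
  refine ⟨Polynomial.aeval b (u * Polynomial.X ^ k), fun M hM => ?_, ?_, ?_⟩
  · exact (Polynomial.aeval_eq_sum_range (x := b) (p := u * Polynomial.X ^ k)) ▸
      (Commute.sum_left _ _ _ fun i _ => (hM.pow_left i).smul_left _)
  · rw [hc, ← map_mul, ← sub_eq_zero, ← map_sub]
    have : u * Polynomial.X ^ (k + 1) * (u * Polynomial.X ^ (k + 1)) - u * Polynomial.X ^ (k + 1)
        = -(u * Polynomial.X * v) * (Polynomial.X ^ k * q) := by
      linear_combination (u * Polynomial.X ^ (k + 1)) * huv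
    rw [this, hzero]
  · rw [hc]
    intro h0
    refine hb ⟨k, ?_⟩
    have h1 : Polynomial.aeval b (v * q) = 1 := by
      have := congrArg (Polynomial.aeval b) huv
      rwa [map_add, h0, zero_add, map_one] at this
    calc b ^ k = Polynomial.aeval b (Polynomial.X ^ k) * Polynomial.aeval b (v * q) := by
          rw [h1]; simp
      _ = 0 := by
        rw [← map_mul, mul_left_comm, hzero]

/-- The composite b = p₁q₁ of (E, δ) → D → (E, δ) commutes with every δ. If b is not nilpotent, so
does its nonzero Fitting idempotent bc = ar, whose image (E, rδa) is a summand of (E, δ) on which b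
is invertible, hence also a summand of D. -/
theorem NoIdentitySummand.isNilpotent {n m : ℕ} {δ : Fin l → Matrix (Fin n) (Fin n) ℂ}
    {D : Fin (l + 1) → Matrix (Fin m) (Fin m) ℂ} (hD : NoIdentitySummand D)
    {q₁ q₂ : Matrix (Fin m) (Fin n) ℂ} {p₁ p₂ : Matrix (Fin n) (Fin m) ℂ}
    (hq : ∀ j, q₁ * consTuple 1 δ j = D j * q₂) (hp : ∀ j, p₁ * D j = consTuple 1 δ j * p₂) :
    IsNilpotent (p₁ * q₁) := by
  by_contra hnil
  have hq0 : q₁ = D 0 * q₂ := by simpa [consTuple] using hq 0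
  have hp0 : p₁ * D 0 = p₂ := by simpa [consTuple] using hp 0
  have hb : p₁ * q₁ = p₂ * q₂ := by rw [hq0, ← Matrix.mul_assoc, hp0]
  have hcomm : ∀ j, Commute (p₁ * q₁) (consTuple 1 δ j) := by
    intro j
    change p₁ * q₁ * _ = _ * (p₁ * q₁)
    rw [Matrix.mul_assoc, hq, ← Matrix.mul_assoc, hp, hb, Matrix.mul_assoc]
  obtain ⟨c, hc, hidem, hne⟩ := exists_idempotent_of_not_isNilpotent hnil
  set b := p₁ * q₁ with hbdef
  have hce : ∀ j, c * consTuple 1 δ j = consTuple 1 δ j * c := fun j => hc _ (hcomm j)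
  have hbc : c * b = b * c := hc _ (Commute.refl b)
  obtain ⟨w, a, r, her, hra⟩ := exists_split_of_idempotent hidem
  have hej : ∀ j, (a * r) * consTuple 1 δ j = consTuple 1 δ j * (a * r) := by
    intro j
    rw [← her, Matrix.mul_assoc, hce, ← Matrix.mul_assoc, (hcomm j).eq, Matrix.mul_assoc]
  have hec : (a * r) * c = c * (a * r) := by
    rw [← her, ← Matrix.mul_assoc c, hbc]
  have hea : ∀ x : Matrix (Fin n) (Fin w) ℂ, x = a → a * r * x = x := by
    rintro x rfl
    rw [Matrix.mul_assoc, hra, Matrix.mul_one]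
  have hre : r * (a * r) = r := by rw [← Matrix.mul_assoc, hra, Matrix.one_mul]
  have hw : 0 < w := by
    rcases Nat.eq_zero_or_pos w with rfl | h
    · exact (hne (by rw [her]; ext i j; simp [Matrix.mul_apply])).elim
    · exact h
  have hone : r * (b * c) * a = 1 := by
    rw [her, hre, hra]
  -- The factor c inverts b on the image of the idempotent: rc·p₁q₁·a = r(bc)a = 1.
  obtain ⟨m', D', hD'⟩ := exists_pqEquiv_tupleSum_of_split
    (W := consTuple 1 fun j => r * δ j * a) (D := D) (s₁ := q₁ * a) (s₂ := q₂ * a)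
    (t₁ := r * c * p₁) (t₂ := r * c * p₂)
    (by
      rw [← hone, ← hbc, hbdef]
      simp only [Matrix.mul_assoc])
    (by
      rw [← hone, ← hbc, hb]
      simp only [Matrix.mul_assoc])
    (by
      have h1 : ∀ j, D j * (q₂ * a) = q₁ * a * (r * consTuple 1 δ j * a) := by
        intro j
        calc D j * (q₂ * a) = q₁ * (consTuple 1 δ j * (a * r * a)) := by
              rw [hea a rfl, ← Matrix.mul_assoc, ← hq, Matrix.mul_assoc]
          _ = q₁ * ((a * r) * consTuple 1 δ j * a) := by rw [hej]; simp only [Matrix.mul_assoc]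
          _ = _ := by simp only [Matrix.mul_assoc]
      intro j
      rw [h1]
      refine Fin.cases ?_ (fun j => ?_) j
      · simp [consTuple, hra]
      · simp [consTuple])
    (by
      have h1 : ∀ j, r * c * p₁ * D j = (r * consTuple 1 δ j * a) * (r * c * p₂) := by
        intro j
        calc r * c * p₁ * D j = r * (c * consTuple 1 δ j) * p₂ := by
              rw [Matrix.mul_assoc, hp]; simp only [Matrix.mul_assoc]
          _ = r * (a * r) * (consTuple 1 δ j * c) * p₂ := by rw [hre, hce]
          _ = r * ((a * r) * consTuple 1 δ j) * c * p₂ := by simp only [Matrix.mul_assoc]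
          _ = _ := by rw [hej]; simp only [Matrix.mul_assoc]
      intro j
      rw [h1]
      refine Fin.cases ?_ (fun j => ?_) j
      · simp [consTuple, hra]
      · simp [consTuple])
  exact hD ⟨w, m', _, D', hw, hD'⟩

theorem intertwine_blocks {α β γ δ : Type} [Fintype α] [Fintype β] [Fintype γ] [Fintype δ]
    {P Q : Matrix (γ ⊕ δ) (α ⊕ β) ℂ} {U : Matrix α α ℂ} {D : Matrix β β ℂ} {U' : Matrix γ γ ℂ}
    {B : Matrix δ δ ℂ} (h : P * fromBlocks U 0 0 D = fromBlocks U' 0 0 B * Q) :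
    P.toBlocks₁₁ * U = U' * Q.toBlocks₁₁ ∧ P.toBlocks₁₂ * D = U' * Q.toBlocks₁₂ ∧
      P.toBlocks₂₁ * U = B * Q.toBlocks₂₁ ∧ P.toBlocks₂₂ * D = B * Q.toBlocks₂₂ := by
  rw [← fromBlocks_toBlocks P, ← fromBlocks_toBlocks Q, fromBlocks_multiply,
    fromBlocks_multiply] at h
  simpa [fromBlocks_inj] using h

/-- One minus a nilpotent matrix is invertible. The conclusion is only right invertibility of P₁₁,
which may still be rectangular because n = n' is not yet known. -/
theorem exists_isUnit_toBlocks_of_pqEquiv {n m n' m' : ℕ} {δ : Fin l → Matrix (Fin n) (Fin n) ℂ}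
    {D : Fin (l + 1) → Matrix (Fin m) (Fin m) ℂ} {γ : Fin l → Matrix (Fin n') (Fin n') ℂ}
    {B : Fin (l + 1) → Matrix (Fin m') (Fin m') ℂ} (hD : NoIdentitySummand D)
    (h : PQEquiv (tupleSum (consTuple 1 δ) D) (tupleSum (consTuple 1 γ) B)) :
    ∃ P Q : Matrix (Fin n' ⊕ Fin m') (Fin n ⊕ Fin m) ℂ, IsILO P ∧ IsILO Q ∧
      (∀ j, P * tupleSum (consTuple 1 δ) D j = tupleSum (consTuple 1 γ) B j * Q) ∧
      ∃ R : Matrix (Fin n) (Fin n') ℂ, IsUnit (P.toBlocks₁₁ * R) := by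
  obtain ⟨P, Q, ⟨P', hP1, hP2⟩, ⟨Q', hQ1, hQ2⟩, h⟩ := h
  have h1 : ∀ j, P * tupleSum (consTuple 1 δ) D j = tupleSum (consTuple 1 γ) B j * Q' := by
    intro j
    rw [← h, Matrix.mul_assoc, hQ1, Matrix.mul_one]
  have h2 : ∀ j, P' * tupleSum (consTuple 1 γ) B j = tupleSum (consTuple 1 δ) D j * Q := by
    intro j
    rw [← h, Matrix.mul_assoc, ← Matrix.mul_assoc, hP2, Matrix.one_mul]
  refine ⟨P, Q', ⟨P', hP1, hP2⟩, ⟨Q, hQ2, hQ1⟩, h1, P'.toBlocks₁₁, ?_⟩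
  have hnil : IsNilpotent (P.toBlocks₁₂ * P'.toBlocks₂₁) :=
    hD.isNilpotent (δ := γ) (q₂ := Q.toBlocks₂₁) (p₂ := Q'.toBlocks₁₂)
      (fun j => (intertwine_blocks (h2 j)).2.2.1) (fun j => (intertwine_blocks (h1 j)).2.1)
  have hsum : P.toBlocks₁₁ * P'.toBlocks₁₁ = 1 - P.toBlocks₁₂ * P'.toBlocks₂₁ := by
    have h3 := hP1
    rw [← fromBlocks_toBlocks P, ← fromBlocks_toBlocks P', fromBlocks_multiply,
      ← fromBlocks_one, fromBlocks_inj] at h3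
    rw [← h3.1, add_sub_cancel_right]
  rw [hsum]
  exact hnil.isUnit_one_sub

theorem isILO_schur {κ : Type} [Fintype κ] [DecidableEq κ] {A X : Matrix ι ι ℂ}
    {B : Matrix ι κ ℂ} {C : Matrix κ ι ℂ} {D : Matrix κ κ ℂ} (h : IsILO (fromBlocks A B C D))
    (h1 : A * X = 1) (h2 : X * A = 1) : IsILO (D - C * X * B) := by
  have : Invertible A := ⟨X, h2, h1⟩
  rw [isILO_iff_isUnit] at h ⊢
  have h3 := isUnit_fromBlocks_iff_of_invertible₁₁.1 h
  rwa [invOf_eq_right_inv h1] at h3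

/-- The previous lemma in both directions gives n = n' and an invertible P₁₁ = Q₁₁, which
intertwines δ and γ. Clearing the off-diagonal blocks leaves the Schur complements of P and Q, and
these carry D to B. -/
theorem pqEquiv_of_pqEquiv_tupleSum {n m n' m' : ℕ} {δ : Fin l → Matrix (Fin n) (Fin n) ℂ}
    {D : Fin (l + 1) → Matrix (Fin m) (Fin m) ℂ} {γ : Fin l → Matrix (Fin n') (Fin n') ℂ}
    {B : Fin (l + 1) → Matrix (Fin m') (Fin m') ℂ} (hD : NoIdentitySummand D)
    (hB : NoIdentitySummand B)
    (h : PQEquiv (tupleSum (consTuple 1 δ) D) (tupleSum (consTuple 1 γ) B)) :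
    n = n' ∧ SimSimilar δ γ ∧ PQEquiv D B := by
  have hle : ∀ {a b : ℕ} (X : Matrix (Fin a) (Fin b) ℂ) (Y : Matrix (Fin b) (Fin a) ℂ),
      IsUnit (X * Y) → a ≤ b := by
    intro a b X Y hXY
    have h1 := Matrix.rank_of_isUnit _ hXY
    rw [Fintype.card_fin] at h1
    rw [← h1]
    exact (Matrix.rank_mul_le_left X Y).trans (Matrix.rank_le_width X)
  obtain ⟨P, Q, hP, hQ, hPQ, R, hR⟩ := exists_isUnit_toBlocks_of_pqEquiv hD h
  obtain ⟨P', Q', -, -, -, R', hR'⟩ := exists_isUnit_toBlocks_of_pqEquiv hB h.symm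
  obtain rfl : n = n' := le_antisymm (hle _ _ hR') (hle _ _ hR)
  obtain rfl : m = m' := by
    have := h.card_eq
    simp only [Fintype.card_sum, Fintype.card_fin] at this
    omega
  have hu : IsUnit P.toBlocks₁₁ := by
    rw [Matrix.isUnit_iff_isUnit_det, det_mul] at hR
    exact (Matrix.isUnit_iff_isUnit_det _).2 (isUnit_of_mul_isUnit_left hR)
  have hblock := fun j => intertwine_blocks (hPQ j)
  have hQ11 : P.toBlocks₁₁ = Q.toBlocks₁₁ := by simpa [consTuple] using (hblock 0).1
  obtain ⟨X, hX1, hX2⟩ := isILO_iff_isUnit.2 hu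
  refine ⟨rfl, simSimilar_of_intertwine hX1 hX2 fun j => ?_, ?_⟩
  · have := (hblock j.succ).1
    rw [← hQ11] at this
    simpa [consTuple] using this
  · have hschur : ∀ M : Matrix (Fin n ⊕ Fin m) (Fin n ⊕ Fin m) ℂ, IsILO M →
        M.toBlocks₁₁ = P.toBlocks₁₁ →
        IsILO (M.toBlocks₂₂ - M.toBlocks₂₁ * X * M.toBlocks₁₂) := by
      intro M hM hM11
      refine isILO_schur (A := P.toBlocks₁₁) ?_ hX1 hX2
      rwa [← hM11, fromBlocks_toBlocks]
    have hS1 := hschur P hP rfl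
    obtain ⟨S, hS2, hS3⟩ := hschur Q hQ hQ11.symm
    refine ⟨_, S, hS1, ⟨_, hS3, hS2⟩, fun j => ?_⟩
    obtain ⟨e11, e12, e21, e22⟩ := hblock j
    -- The inverse of P₁₁ intertwines in the opposite direction; this lets the correction terms
    -- P₂₁XP₁₂ and Q₂₁XQ₁₂ match.
    have hXU : X * consTuple 1 γ j = consTuple 1 δ j * X := by
      calc X * consTuple 1 γ j = X * (consTuple 1 γ j * Q.toBlocks₁₁) * X := by
            rw [← hQ11, Matrix.mul_assoc X, Matrix.mul_assoc _ _ X, hX1, Matrix.mul_one]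
        _ = _ := by rw [← e11, ← Matrix.mul_assoc X, hX2, Matrix.one_mul]
    have hS : (P.toBlocks₂₂ - P.toBlocks₂₁ * X * P.toBlocks₁₂) * D j =
        B j * (Q.toBlocks₂₂ - Q.toBlocks₂₁ * X * Q.toBlocks₁₂) := by
      rw [Matrix.sub_mul, Matrix.mul_sub, e22]
      congr 1
      calc P.toBlocks₂₁ * X * P.toBlocks₁₂ * D j
          = P.toBlocks₂₁ * (X * consTuple 1 γ j) * Q.toBlocks₁₂ := by
            rw [Matrix.mul_assoc _ P.toBlocks₁₂, e12]; simp only [Matrix.mul_assoc]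
        _ = (P.toBlocks₂₁ * consTuple 1 δ j) * X * Q.toBlocks₁₂ := by
            rw [hXU]; simp only [Matrix.mul_assoc]
        _ = _ := by rw [e21]; simp only [Matrix.mul_assoc]
    rw [hS, Matrix.mul_assoc, hS2, Matrix.mul_one]

end Cancellation

/-! ### The commuting pair composed of a tuple -/

section ComposedPair

open Kronecker

variable {κ : Type} {l n : ℕ}

/-- This and the next four formulas turn the intertwining equations into recursions between entries:
a factor on the right shifts the column monomial up, a factor on the left shifts the row monomial
down. -/
theorem mul_pairX_apply (M : Matrix κ (MonIdx l × Fin n) ℂ) (u : κ) (b : ℕ) (hb : b < l) (a : ℕ)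
    (ha : a < l - b + 1) (ha' : a + 1 < l - b + 1) (q : Fin n) :
    (M * pairX l n) u (⟨⟨b, hb⟩, ⟨a, ha⟩⟩, q) = M u (⟨⟨b, hb⟩, ⟨a + 1, ha'⟩⟩, q) := by
  rw [Matrix.mul_apply, Finset.sum_eq_single (⟨⟨b, hb⟩, ⟨a + 1, ha'⟩⟩, q)]
  · simp [pairX]
  · rintro ⟨⟨⟨b₁, hb₁⟩, ⟨a₁, ha₁⟩⟩, q₁⟩ - hne
    have : ¬ (b₁ = b ∧ a₁ = a + 1 ∧ q₁ = q) := by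
      rintro ⟨rfl, rfl, rfl⟩
      exact hne rfl
    simp [pairX, this]
  · simp

theorem mul_pairX_apply_top (M : Matrix κ (MonIdx l × Fin n) ℂ) (u : κ) (b : ℕ) (hb : b < l)
    (a : ℕ) (ha : a < l - b + 1) (ha' : ¬ a + 1 < l - b + 1) (q : Fin n) :
    (M * pairX l n) u (⟨⟨b, hb⟩, ⟨a, ha⟩⟩, q) = 0 := by
  rw [Matrix.mul_apply]
  refine Finset.sum_eq_zero ?_
  rintro ⟨⟨⟨b₁, hb₁⟩, ⟨a₁, ha₁⟩⟩, q₁⟩ -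
  have : ¬ (b₁ = b ∧ a₁ = a + 1 ∧ q₁ = q) := by
    rintro ⟨rfl, rfl, rfl⟩
    exact ha' ha₁
  simp [pairX, this]

theorem pairX_mul_apply (M : Matrix (MonIdx l × Fin n) κ ℂ) (w : κ) (b : ℕ) (hb : b < l) (a : ℕ)
    (ha : a < l - b + 1) (p : Fin n) :
    (pairX l n * M) (⟨⟨b, hb⟩, ⟨a, ha⟩⟩, p) w =
      if 0 < a then M (⟨⟨b, hb⟩, ⟨a - 1, (Nat.sub_le a 1).trans_lt ha⟩⟩, p) w else 0 := by
  rw [Matrix.mul_apply]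
  split_ifs with h
  · rw [Finset.sum_eq_single (⟨⟨b, hb⟩, ⟨a - 1, (Nat.sub_le a 1).trans_lt ha⟩⟩, p)]
    · have : a = a - 1 + 1 := by omega
      simp [pairX, ← this]
    · rintro ⟨⟨⟨b₁, hb₁⟩, ⟨a₁, ha₁⟩⟩, q₁⟩ - hne
      have : ¬ (b = b₁ ∧ a = a₁ + 1 ∧ p = q₁) := by
        rintro ⟨rfl, rfl, rfl⟩
        exact hne rfl
      simp [pairX, this]
    · simp
  · refine Finset.sum_eq_zero ?_
    rintro ⟨⟨⟨b₁, hb₁⟩, ⟨a₁, ha₁⟩⟩, q₁⟩ -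
    have : ¬ a = a₁ + 1 := by omega
    simp [pairX, this]

theorem mul_pairY_apply (M : Matrix κ (MonIdx l × Fin n) ℂ) (γ : Fin l → Matrix (Fin n) (Fin n) ℂ)
    (u : κ) (b : ℕ) (hb : b + 1 < l) (a : ℕ) (ha : a < l - b + 1) (ha' : a < l - (b + 1) + 1)
    (q : Fin n) :
    (M * pairY γ) u (⟨⟨b, (Nat.lt_succ_self b).trans hb⟩, ⟨a, ha⟩⟩, q) =
      M u (⟨⟨b + 1, hb⟩, ⟨a, ha'⟩⟩, q) := by
  have hb' : b + 1 ≠ l := by omega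
  rw [Matrix.mul_apply, Finset.sum_eq_single (⟨⟨b + 1, hb⟩, ⟨a, ha'⟩⟩, q)]
  · simp [pairY]
  · rintro ⟨⟨⟨b₁, hb₁⟩, ⟨a₁, ha₁⟩⟩, q₁⟩ - hne
    have : ¬ (b₁ = b + 1 ∧ a₁ = a ∧ q₁ = q) := by
      rintro ⟨rfl, rfl, rfl⟩
      exact hne rfl
    simp [pairY, this, hb']
  · simp

theorem pairY_mul_apply (γ : Fin l → Matrix (Fin n) (Fin n) ℂ)
    (M : Matrix (MonIdx l × Fin n) κ ℂ) (w : κ) (b : ℕ) (hb : b < l) (a : ℕ)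
    (ha : a < l - b + 1) (p : Fin n) :
    (pairY γ * M) (⟨⟨b, hb⟩, ⟨a, ha⟩⟩, p) w =
      (if 0 < b then M (⟨⟨b - 1, by omega⟩, ⟨a, by simp only; omega⟩⟩, p) w else 0) +
        if a + b = l then ∑ p', γ ⟨b, hb⟩ p p' *
          M (⟨⟨l - 1, by omega⟩, ⟨0, Nat.succ_pos _⟩⟩, p') w else 0 := by
  have hsplit : ∀ v : MonIdx l × Fin n, pairY γ (⟨⟨b, hb⟩, ⟨a, ha⟩⟩, p) v =
      (if b = (v.1.1 : ℕ) + 1 ∧ a = (v.1.2 : ℕ) ∧ p = v.2 then 1 else 0) +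
        if (v.1.1 : ℕ) + 1 = l ∧ (v.1.2 : ℕ) = 0 ∧ a + b = l then γ ⟨b, hb⟩ p v.2 else 0 := by
    intro v
    simp only [pairY, Matrix.of_apply]
    split_ifs with h1 h2 h2
    · omega
    · simp
    · simp
    · simp
  rw [Matrix.mul_apply]
  simp only [hsplit, add_mul, Finset.sum_add_distrib]
  congr 1
  · split_ifs with h
    · rw [Finset.sum_eq_single (⟨⟨b - 1, by omega⟩, ⟨a, by simp only; omega⟩⟩, p)]
      · have : b = b - 1 + 1 := by omega
        simp [← this]
      · rintro ⟨⟨⟨b₁, hb₁⟩, ⟨a₁, ha₁⟩⟩, q₁⟩ - hne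
        have : ¬ (b = b₁ + 1 ∧ a = a₁ ∧ p = q₁) := by
          rintro ⟨rfl, rfl, rfl⟩
          exact hne rfl
        simp [this]
      · simp
    · refine Finset.sum_eq_zero ?_
      rintro ⟨⟨⟨b₁, hb₁⟩, ⟨a₁, ha₁⟩⟩, q₁⟩ -
      have : ¬ b = b₁ + 1 := by omega
      simp [this]
  · split_ifs with h
    · rw [Fintype.sum_prod_type, Finset.sum_eq_single ⟨⟨l - 1, by omega⟩, ⟨0, Nat.succ_pos _⟩⟩]
      · have : l - 1 + 1 = l := by omega
        simp [this, h]
      · rintro ⟨⟨b₁, hb₁⟩, ⟨a₁, ha₁⟩⟩ - hne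
        have : ¬ (b₁ + 1 = l ∧ a₁ = 0) := by
          rintro ⟨h1, rfl⟩
          obtain rfl : b₁ = l - 1 := by omega
          exact hne rfl
        refine Finset.sum_eq_zero fun p' _ => ?_
        rw [if_neg (fun h => this ⟨h.1, h.2.1⟩), zero_mul]
      · simp
    · exact Finset.sum_eq_zero fun v _ => by simp [h]

/-- Only on y^(l−1) does the relation for y^l interfere, and there both orders of multiplication
produce degree l + 1, which is zero. -/
theorem commute_pairX_pairY (γ : Fin l → Matrix (Fin n) (Fin n) ℂ) :
    Commute (pairX l n) (pairY γ) := by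
  change pairX l n * pairY γ = pairY γ * pairX l n
  ext ⟨⟨⟨b, hb⟩, ⟨a, ha⟩⟩, p⟩ ⟨⟨⟨b', hb'⟩, ⟨a', ha'⟩⟩, q⟩
  change a < l - b + 1 at ha
  change a' < l - b' + 1 at ha'
  rw [pairX_mul_apply]
  by_cases h : a' + 1 < l - b' + 1
  · rw [mul_pairX_apply _ _ _ _ _ _ h]
    simp only [pairY, Matrix.of_apply]
    split_ifs <;> first | rfl | omega | grind
  · rw [mul_pairX_apply_top _ _ _ _ _ _ h]
    simp only [pairY, Matrix.of_apply]
    split_ifs <;> first | rfl | omega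

/-- Every column monomial is obtained from 1 by multiplications by x and y, and K commutes with
these; so K is block triangular by degree, with the same block at every monomial. The induction is
on the degree of the column. -/
theorem pair_intertwine_apply {γ γ' : Fin l → Matrix (Fin n) (Fin n) ℂ} (hl : 0 < l)
    {K : Matrix (MonIdx l × Fin n) (MonIdx l × Fin n) ℂ}
    (hX : K * pairX l n = pairX l n * K) (hY : K * pairY γ = pairY γ' * K) (d : ℕ) :
    ∀ (b : ℕ) (hb : b < l) (a : ℕ) (ha : a < l - b + 1) (b' : ℕ) (hb' : b' < l) (a' : ℕ)
      (ha' : a' < l - b' + 1) (p q : Fin n), b' + a' = d → b + a ≤ d →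
      K (⟨⟨b, hb⟩, ⟨a, ha⟩⟩, p) (⟨⟨b', hb'⟩, ⟨a', ha'⟩⟩, q) =
        if b = b' ∧ a = a' then
          K (⟨⟨0, hl⟩, ⟨0, Nat.succ_pos _⟩⟩, p) (⟨⟨0, hl⟩, ⟨0, Nat.succ_pos _⟩⟩, q) else 0 := by
  induction d with
  | zero =>
    intro b hb a ha b' hb' a' ha' p q h1 h2
    obtain ⟨rfl, rfl⟩ : b' = 0 ∧ a' = 0 := by omega
    obtain ⟨rfl, rfl⟩ : b = 0 ∧ a = 0 := by omega
    simp
  | succ d ih =>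
    intro b hb a ha b' hb' a' ha' p q h1 h2
    rcases a' with _ | a'
    · obtain rfl : b' = d + 1 := by omega
      -- Here b' = d + 1 < l, so neither side meets the relation for y^l.
      have e : (K * pairY γ) (⟨⟨b, hb⟩, ⟨a, ha⟩⟩, p)
          (⟨⟨d, by omega⟩, ⟨0, Nat.succ_pos _⟩⟩, q) = _ :=
        mul_pairY_apply _ _ _ d hb' 0 (Nat.succ_pos _) ha' q
      rw [← e, hY, pairY_mul_apply, if_neg (show ¬ a + b = l by omega), add_zero]
      rcases b with _ | b
      · simp
      · rw [if_pos (Nat.succ_pos b)]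
        refine (ih b _ a _ d _ 0 _ p q rfl (by omega)).trans ?_
        simp
    · rw [← mul_pairX_apply K _ b' hb' a' (by omega) ha', hX, pairX_mul_apply]
      rcases a with _ | a
      · simp
      · rw [if_pos (Nat.succ_pos a)]
        refine (ih b _ a _ b' _ a' _ p q (by omega) (by omega)).trans ?_
        simp

/-- The block of the intertwiner at the monomial 1 is the similarity between γ and γ'. -/
theorem simSimilar_of_simSimilar_pair {γ γ' : Fin l → Matrix (Fin n) (Fin n) ℂ}
    (h : SimSimilar ![pairX l n, pairY γ] ![pairX l n, pairY γ']) : SimSimilar γ γ' := by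
  rcases Nat.eq_zero_or_pos l with rfl | hl
  · exact ⟨1, 1, by simp, by simp, fun j => j.elim0⟩
  obtain ⟨P, R, h1, h2, h3, h4⟩ := h.exists_intertwine
  let o : MonIdx l := ⟨⟨0, hl⟩, ⟨0, Nat.succ_pos _⟩⟩
  -- The row of an intertwiner at the monomial 1 vanishes off the column 1, so corners multiply and
  -- the corner of the inverse is inverse to the corner.
  have hinv : ∀ {γ γ' : Fin l → Matrix (Fin n) (Fin n) ℂ}
      {P R : Matrix (MonIdx l × Fin n) (MonIdx l × Fin n) ℂ},
      P * pairX l n = pairX l n * P → P * pairY γ = pairY γ' * P → P * R = 1 →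
      (Matrix.of fun p q => P (o, p) (o, q)) * (Matrix.of fun p q => R (o, p) (o, q)) = 1 := by
    intro γ γ' P R hX hY hPR
    ext p q
    have e := congrFun (congrFun hPR (o, p)) (o, q)
    rw [Matrix.mul_apply, Fintype.sum_prod_type, Finset.sum_eq_single o] at e
    · rw [Matrix.mul_apply]
      simpa [Matrix.one_apply] using e
    · rintro ⟨⟨b, hb⟩, ⟨a, ha⟩⟩ - hne
      refine Finset.sum_eq_zero fun p' _ => ?_
      rw [pair_intertwine_apply hl hX hY _ 0 hl 0 _ b hb a ha p p' rfl (by omega), if_neg, zero_mul]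
      rintro ⟨rfl, rfl⟩
      exact hne rfl
    · simp
  have hX := h3 0
  have hY := h3 1
  simp only [Matrix.cons_val_zero, Matrix.cons_val_one] at hX hY
  refine simSimilar_of_intertwine (hinv hX hY h1) (hinv (h4 0) (h4 1) h2) ?_
  rintro ⟨c, hc⟩
  ext p q
  have key := pair_intertwine_apply hl hX hY
  -- The row x^(l−c)y^c and the column y^(l−1) isolate the coefficient of y^l that carries γ_c on
  -- one side and γ'_c on the other.
  have e := congrFun (congrFun hY (⟨⟨c, hc⟩, ⟨l - c, Nat.lt_succ_self _⟩⟩, p))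
    (⟨⟨l - 1, by omega⟩, ⟨0, Nat.succ_pos _⟩⟩, q)
  have hzero : (if 0 < c then P (⟨⟨c - 1, by omega⟩, ⟨l - c, by simp only; omega⟩⟩, p)
      (⟨⟨l - 1, by omega⟩, ⟨0, Nat.succ_pos _⟩⟩, q) else 0) = 0 := by
    split_ifs with hc0
    · refine (key (l - 1) (c - 1) _ (l - c) _ (l - 1) _ 0 _ p q (by omega) (by omega)).trans ?_
      rw [if_neg (by omega)]
    · rfl
  rw [pairY_mul_apply, hzero, zero_add, if_pos (show l - c + c = l by omega)] at e
  rw [Matrix.mul_apply, Matrix.mul_apply]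
  simp only [Matrix.of_apply]
  rw [Matrix.mul_apply, Fintype.sum_prod_type,
    Finset.sum_eq_single ⟨⟨c, hc⟩, ⟨l - c, Nat.lt_succ_self _⟩⟩] at e
  · refine Eq.trans (Finset.sum_congr rfl fun p' _ => ?_)
      (e.trans (Finset.sum_congr rfl fun p' _ => ?_))
    · rw [key l c hc (l - c) _ c hc (l - c) _ p p' (by omega) (by omega), if_pos ⟨rfl, rfl⟩]
      congr 1
      have h1 : ¬ c = l := by omega
      have h2 : l - 1 + 1 = l := by omega
      have h3 : l - c + c = l := by omega
      simp [pairY, h1, h2, h3]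
    · rw [key (l - 1) (l - 1) _ 0 _ (l - 1) _ 0 _ p' q (by omega) (by omega), if_pos ⟨rfl, rfl⟩]
  · rintro ⟨⟨b, hb⟩, ⟨a, ha⟩⟩ - hne
    refine Finset.sum_eq_zero fun p' _ => ?_
    by_cases hab : b + a = l
    · rw [key l c hc (l - c) _ b hb a ha p p' (by omega) (by omega), if_neg, zero_mul]
      rintro ⟨rfl, rfl⟩
      exact hne rfl
    · have h1 : ¬ b = l - 1 + 1 := by omega
      have h3 : ¬ a + b = l := by omega
      simp [pairY, h1, h3]
  · simp

/-- In tensor form it is evident that 1 ⊗ P intertwines the pairs whenever P intertwines the tuples.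
-/
theorem pairY_eq_kronecker (γ : Fin l → Matrix (Fin n) (Fin n) ℂ) :
    pairY γ = (Matrix.of fun u v : MonIdx l =>
        if (u.1 : ℕ) = (v.1 : ℕ) + 1 ∧ (u.2 : ℕ) = (v.2 : ℕ) then (1 : ℂ) else 0) ⊗ₖ 1 +
      ∑ c, (Matrix.of fun u v : MonIdx l =>
        if (v.1 : ℕ) + 1 = l ∧ (v.2 : ℕ) = 0 ∧ (u.2 : ℕ) + (u.1 : ℕ) = l ∧ u.1 = c then (1 : ℂ)
          else 0) ⊗ₖ γ c := by
  ext u v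
  rw [Matrix.add_apply, Matrix.sum_apply, Finset.sum_eq_single u.1.1]
  · simp only [pairY, Matrix.of_apply, Matrix.kroneckerMap_apply, Matrix.one_apply]
    have := u.1.1.isLt
    by_cases h1 : (u.1.1 : ℕ) = (v.1.1 : ℕ) + 1
    · have : (v.1.1 : ℕ) + 1 ≠ l := by omega
      by_cases h2 : u.2 = v.2 <;> simp [this, h1, h2]
    · simp [h1]
  · intro c _ hc
    simp [hc.symm]
  · simp

theorem pairX_eq_kronecker : pairX l n = (Matrix.of fun u v : MonIdx l =>
    if u.1 = v.1 ∧ (u.2 : ℕ) = (v.2 : ℕ) + 1 then (1 : ℂ) else 0) ⊗ₖ 1 := by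
  ext u v
  by_cases h : u.2 = v.2 <;> simp [pairX, h, Matrix.one_apply]

theorem simSimilar_pair_of_simSimilar {γ γ' : Fin l → Matrix (Fin n) (Fin n) ℂ}
    (h : SimSimilar γ γ') : SimSimilar ![pairX l n, pairY γ] ![pairX l n, pairY γ'] := by
  obtain ⟨P, R, h1, h2, h3, -⟩ := h.exists_intertwine
  refine simSimilar_of_intertwine (P := (1 : Matrix (MonIdx l) (MonIdx l) ℂ) ⊗ₖ P)
    (R := (1 : Matrix (MonIdx l) (MonIdx l) ℂ) ⊗ₖ R) ?_ ?_ fun j => ?_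
  · rw [← Matrix.mul_kronecker_mul, h1, Matrix.one_mul, Matrix.one_kronecker_one]
  · rw [← Matrix.mul_kronecker_mul, h2, Matrix.one_mul, Matrix.one_kronecker_one]
  · fin_cases j
    · simp [pairX_eq_kronecker, ← Matrix.mul_kronecker_mul]
    · simp [pairY_eq_kronecker, ← Matrix.mul_kronecker_mul, Matrix.mul_add, Matrix.add_mul,
        Matrix.mul_sum, Matrix.sum_mul, h3]

end ComposedPair

/-! ### Polynomials in a Jordan block and the Jordan normal form -/

section Jordan

open Polynomial

variable {κ : Type} {n : ℕ}

theorem jordanBlock_zero_pow_apply (k : ℕ) (p q : Fin n) :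
    (jordanBlock n 0 ^ k) p q = if (p : ℕ) + k = q then 1 else 0 := by
  induction k generalizing p with
  | zero => simp [Matrix.one_apply, Fin.ext_iff]
  | succ k ih =>
    rw [pow_succ', Matrix.mul_apply]
    simp only [ih]
    by_cases h : (p : ℕ) + 1 < n
    · rw [Finset.sum_eq_single ⟨(p : ℕ) + 1, h⟩]
      · simp [jordanBlock, Fin.ext_iff, add_assoc, add_comm 1 k]
      · intro v _ hv
        have : ¬ (p : ℕ) + 1 = v := fun h' => hv (Fin.ext h'.symm)
        simp [jordanBlock, this]
      · simp
    · rw [Finset.sum_eq_zero, if_neg (by omega)]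
      intro v _
      have : ¬ (p : ℕ) + 1 = v := by omega
      simp [jordanBlock, this]

theorem aeval_jordanBlock_zero_apply (f : ℂ[X]) (p q : Fin n) :
    aeval (jordanBlock n 0) f p q = if p ≤ q then f.coeff ((q : ℕ) - p) else 0 := by
  induction f using Polynomial.induction_on' with
  | add f g hf hg =>
    rw [map_add, Matrix.add_apply, hf, hg, coeff_add]
    split_ifs <;> simp
  | monomial k c =>
    rw [aeval_monomial, Algebra.algebraMap_eq_smul_one, Matrix.smul_mul, Matrix.one_mul,
      Matrix.smul_apply, jordanBlock_zero_pow_apply, coeff_monomial, smul_eq_mul, mul_ite, mul_one,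
      mul_zero]
    split_ifs <;> first | rfl | omega

theorem jordanBlock_eq_add (n : ℕ) (lam : ℂ) :
    jordanBlock n lam = jordanBlock n 0 + algebraMap ℂ _ lam := by
  ext p q
  by_cases h : p = q <;> simp [jordanBlock, Matrix.algebraMap_matrix_apply, h]

theorem aeval_jordanBlock_apply (lam : ℂ) (f : ℂ[X]) (p q : Fin n) :
    aeval (jordanBlock n lam) f p q =
      if p ≤ q then (f.comp (X + C lam)).coeff ((q : ℕ) - p) else 0 := by
  rw [← aeval_jordanBlock_zero_apply, aeval_comp, map_add, aeval_X, aeval_C, jordanBlock_eq_add]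

theorem aeval_jordanBlock_zero_eq_zero_iff (f : ℂ[X]) :
    aeval (jordanBlock n 0) f = 0 ↔ X ^ n ∣ f := by
  rw [X_pow_dvd_iff]
  constructor
  · intro h d hd
    have := congrFun (congrFun h ⟨0, by omega⟩) ⟨d, hd⟩
    simpa [aeval_jordanBlock_zero_apply, Fin.le_def] using this
  · intro h
    ext p q
    rw [aeval_jordanBlock_zero_apply]
    split_ifs
    · exact h _ (by omega)
    · rfl

theorem X_pow_dvd_comp_iff (lam : ℂ) (f : ℂ[X]) :
    X ^ n ∣ f.comp (X + C lam) ↔ (X - C lam) ^ n ∣ f := by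
  constructor
  · rintro ⟨g, hg⟩
    refine ⟨g.comp (X - C lam), ?_⟩
    have := congrArg (fun h => h.comp (X - C lam)) hg
    simpa [comp_assoc] using this
  · rintro ⟨g, rfl⟩
    exact ⟨g.comp (X + C lam), by simp⟩

/-- The block diagonal matrix of Jordan blocks. -/
noncomputable def jordanMatrix [DecidableEq κ] (size : κ → ℕ) (eig : κ → ℂ) :
    Matrix (Σ i, Fin (size i)) (Σ i, Fin (size i)) ℂ :=
  Matrix.blockDiagonal' fun i => jordanBlock (size i) (eig i)

/-- The last basis vector is cyclic: the coordinates of its image under f are the first n Taylor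
coefficients of f at `lam`, so its annihilator is generated by (X − lam)^n. -/
theorem nonempty_quotient_equiv_jordanBlock (n : ℕ) (lam : ℂ) :
    Nonempty ((ℂ[X] ⧸ Submodule.span ℂ[X] {(X - C lam) ^ n}) ≃ₗ[ℂ[X]]
      Module.AEval' (Matrix.toLin' (jordanBlock n lam))) := by
  let φ := Matrix.toLin' (jordanBlock n lam)
  -- The last basis vector, written so that n = 0 is allowed.
  let c : Fin n → ℂ := fun q => if (q : ℕ) + 1 = n then 1 else 0
  let θ : ℂ[X] →ₗ[ℂ[X]] Module.AEval' φ := LinearMap.toSpanSingleton ℂ[X] _ (Module.AEval'.of φ c)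
  have hφ : ∀ f : ℂ[X], aeval φ f = Matrix.toLin' (aeval (jordanBlock n lam) f) := by
    intro f
    exact (aeval_algHom_apply (Matrix.toLinAlgEquiv' (R := ℂ) (n := Fin n)).toAlgHom
      (jordanBlock n lam) f)
  have hθ : ∀ (f : ℂ[X]) (p : Fin n), (Module.AEval'.of φ).symm (θ f) p =
      (f.comp (X + C lam)).coeff (n - 1 - p) := by
    intro f p
    have h1 : (Module.AEval'.of φ).symm (θ f) = aeval φ f c := by
      rw [LinearMap.toSpanSingleton_apply, Module.AEval.of_symm_smul, LinearEquiv.symm_apply_apply]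
      rfl
    have hn : n - 1 < n := by have := p.isLt; omega
    have hp : p ≤ ⟨n - 1, hn⟩ := Fin.le_def.2 (by simp only; omega)
    rw [h1, hφ, Matrix.toLin'_apply, Matrix.mulVec, dotProduct,
      Finset.sum_eq_single ⟨n - 1, hn⟩]
    · have : n - 1 + 1 = n := by omega
      rw [aeval_jordanBlock_apply, if_pos hp]
      simp [c, this]
    · intro q _ hq
      have : ¬ (q : ℕ) + 1 = n := fun h => hq (Fin.ext (by simp only; omega))
      simp [c, this]
    · simp
  have hsurj : Function.Surjective θ := by
    intro w
    refine ⟨(∑ k : Fin n, C ((Module.AEval'.of φ).symm w k) * X ^ (n - 1 - (k : ℕ))).comp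
      (X - C lam), (Module.AEval'.of φ).symm.injective ?_⟩
    funext p
    rw [hθ, comp_assoc]
    simp only [sub_comp, X_comp, C_comp, add_sub_cancel_right, comp_X, finsetSum_coeff,
      coeff_C_mul, coeff_X_pow]
    rw [Finset.sum_eq_single p]
    · simp
    · intro q _ hq
      have : ¬ n - 1 - (p : ℕ) = n - 1 - q := fun h => hq (Fin.ext (by omega))
      simp [this]
    · simp
  have hker : LinearMap.ker θ = Submodule.span ℂ[X] {(X - C lam) ^ n} := by
    ext f
    change f ∈ LinearMap.ker θ ↔ f ∈ Ideal.span {(X - C lam) ^ n}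
    rw [LinearMap.mem_ker, Ideal.mem_span_singleton,
      ← X_pow_dvd_comp_iff, X_pow_dvd_iff, ← (Module.AEval'.of φ).symm.map_eq_zero_iff]
    constructor
    · intro h d hd
      have := congrFun h ⟨n - 1 - d, by omega⟩
      rw [hθ] at this
      have hd' : n - 1 - (n - 1 - d) = d := by omega
      simpa [hd'] using this
    · intro h
      funext p
      rw [hθ]
      exact h _ (by omega)
  exact ⟨(Submodule.quotEquivOfEq _ _ hker.symm).trans (θ.quotKerEquivOfSurjective hsurj)⟩

theorem simSimilar_submatrix {ι κ : Type} [Fintype ι] [DecidableEq ι] [Fintype κ] [DecidableEq κ]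
    {l : ℕ} (γ : Fin l → Matrix κ κ ℂ) (e : ι ≃ κ) :
    SimSimilar γ (fun j => (γ j).submatrix e e) := by
  refine simSimilar_of_intertwine (P := (1 : Matrix κ κ ℂ).submatrix e id)
    (R := (1 : Matrix κ κ ℂ).submatrix id e) ?_ ?_ fun j => ?_
  · rw [← Matrix.submatrix_mul _ _ _ id _ Function.bijective_id]
    simp
  · rw [← Matrix.submatrix_mul _ _ _ e _ e.bijective]
    simp
  · rw [← Matrix.submatrix_mul _ _ _ e _ e.bijective]
    conv_lhs => rw [show γ j = (γ j).submatrix id id by simp]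
    rw [← Matrix.submatrix_mul _ _ _ id _ Function.bijective_id]
    simp

/-- M makes the vector space a finitely generated torsion ℂ[X]-module, hence a sum of cyclic modules
ℂ[X]/(p^e) with p irreducible, that is, linear up to a unit. Exponents e = 0, giving empty blocks,
are not excluded here. -/
theorem exists_simSimilar_jordanMatrix {ι : Type} [Fintype ι] [DecidableEq ι] (M : Matrix ι ι ℂ) :
    ∃ (κ : Type) (_ : Fintype κ) (_ : DecidableEq κ) (size : κ → ℕ) (eig : κ → ℂ),
      SimSimilar (fun _ : Fin 1 => M) (fun _ => jordanMatrix size eig) := by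
  classical
  obtain ⟨κ, hκ, p, hp, e, ⟨E⟩⟩ := Module.equiv_directSum_of_isTorsion
    (Module.AEval.isTorsion_of_finiteDimensional ℂ (ι → ℂ) (Matrix.toLin' M))
  have hlam : ∀ i, ∃ lam : ℂ, Associated (p i) (X - C lam) := by
    intro i
    obtain ⟨lam, hl⟩ := IsAlgClosed.exists_root (p i) (by
      rw [IsAlgClosed.degree_eq_one_of_irreducible ℂ (hp i)]
      exact one_ne_zero)
    exact ⟨lam, ((irreducible_X_sub_C lam).associated_of_dvd (hp i) (dvd_iff_isRoot.2 hl)).symm⟩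
  choose lam hlam using hlam
  have hspan : ∀ i, Submodule.span ℂ[X] {p i ^ e i} =
      Submodule.span ℂ[X] {(X - C (lam i)) ^ e i} := by
    intro i
    exact Ideal.span_singleton_eq_span_singleton.2 ((hlam i).pow_pow)
  have F := fun i => (Submodule.quotEquivOfEq _ _ (hspan i)).trans
    (nonempty_quotient_equiv_jordanBlock (e i) (lam i)).some
  let G : Module.AEval' (Matrix.toLin' M) ≃ₗ[ℂ[X]]
      ((i : κ) → Module.AEval' (Matrix.toLin' (jordanBlock (e i) (lam i)))) :=
    (E.trans (DirectSum.linearEquivFunOnFintype ℂ[X] κ _)).trans (LinearEquiv.piCongrRight F)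
  let Φ : (ι → ℂ) ≃ₗ[ℂ] ((Σ i, Fin (e i)) → ℂ) :=
    (((Module.AEval'.of (Matrix.toLin' M)).trans (G.restrictScalars ℂ)).trans
      (LinearEquiv.piCongrRight fun i =>
        (Module.AEval'.of (Matrix.toLin' (jordanBlock (e i) (lam i)))).symm)).trans
      (LinearEquiv.piCurry ℂ fun i (_ : Fin (e i)) => ℂ).symm
  have hΦ : ∀ v, Φ (M.mulVec v) = (jordanMatrix e lam).mulVec (Φ v) := by
    intro v
    funext ⟨i, q⟩
    have h1 : Module.AEval'.of (Matrix.toLin' M) (M.mulVec v) =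
        (X : ℂ[X]) • Module.AEval'.of (Matrix.toLin' M) v := by
      rw [Module.AEval'.X_smul_of, Matrix.toLin'_apply]
    have h2 : Φ (M.mulVec v) ⟨i, q⟩ = (Module.AEval'.of _).symm
        (G (Module.AEval'.of (Matrix.toLin' M) (M.mulVec v)) i) q := rfl
    have h3 : ∀ q, Φ v ⟨i, q⟩ = (Module.AEval'.of _).symm
        (G (Module.AEval'.of (Matrix.toLin' M) v) i) q := fun q => rfl
    rw [h2, h1, map_smul, Pi.smul_apply, Module.AEval'.of_symm_X_smul, Matrix.toLin'_apply]
    simp only [Matrix.mulVec, dotProduct, Fintype.sum_sigma, jordanMatrix]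
    rw [Finset.sum_eq_single i]
    · simp [h3]
    · intro j _ hj
      simp [Matrix.blockDiagonal'_apply_ne _ _ _ hj.symm]
    · simp
  refine ⟨κ, hκ, inferInstance, e, lam, simSimilar_of_intertwine
    (P := LinearMap.toMatrix' Φ.toLinearMap) (R := LinearMap.toMatrix' Φ.symm.toLinearMap)
    ?_ ?_ fun _ => ?_⟩
  · rw [← LinearMap.toMatrix'_comp]
    simp
  · rw [← LinearMap.toMatrix'_comp]
    simp
  · apply Matrix.toLin'.injective
    refine LinearMap.ext fun v => ?_
    rw [Matrix.toLin'_mul, Matrix.toLin'_mul, Matrix.toLin'_toMatrix']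
    simpa using hΦ v

/-- Empty blocks contribute no index and are dropped, as `EJAParams` asks for positive sizes. -/
theorem exists_simSimilar_jordanMatrix_fin {ι : Type} [Fintype ι] [DecidableEq ι]
    (M : Matrix ι ι ℂ) :
    ∃ (r : ℕ) (size : Fin r → ℕ) (eig : Fin r → ℂ), (∀ i, 0 < size i) ∧
      SimSimilar (fun _ : Fin 1 => M) (fun _ => jordanMatrix size eig) := by
  obtain ⟨κ, _, _, size, eig, h⟩ := exists_simSimilar_jordanMatrix M
  let ε : Fin (Fintype.card {i // 0 < size i}) ≃ {i // 0 < size i} := (Fintype.equivFin _).symm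
  let σ : (Σ j, Fin (size (ε j))) → Σ i, Fin (size i) := fun u => ⟨ε u.1, u.2⟩
  have hσ : Function.Bijective σ := by
    constructor
    · rintro ⟨j, q⟩ ⟨j', q'⟩ h
      have h1 : (ε j : κ) = ε j' := congrArg Sigma.fst h
      obtain rfl : j = j' := ε.injective (Subtype.ext h1)
      have h2 := eq_of_heq (Sigma.mk.inj h).2
      change q = q' at h2
      rw [h2]
    · rintro ⟨i, q⟩
      obtain ⟨j, hj⟩ := ε.surjective ⟨i, Nat.zero_lt_of_lt q.isLt⟩
      have h1 : i = ε j := by rw [hj]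
      subst h1
      exact ⟨⟨j, q⟩, rfl⟩
  refine ⟨_, fun j => size (ε j), fun j => eig (ε j), fun j => (ε j).2, h.trans ?_⟩
  convert simSimilar_submatrix _ (Equiv.ofBijective σ hσ) using 1
  funext _
  ext ⟨i, p⟩ ⟨j, q⟩
  by_cases hij : i = j
  · subst hij
    simp [σ, jordanMatrix]
  · have h1 : (ε i : κ) ≠ ε j := fun h => hij (ε.injective (Subtype.ext h))
    simp [σ, jordanMatrix, Matrix.blockDiagonal'_apply_ne _ _ _ hij,
      Matrix.blockDiagonal'_apply_ne _ _ _ h1]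

end Jordan

/-! ### The centralizer of a Jordan matrix -/

namespace EJAParams

variable (p : EJAParams) {κ : Type}

theorem J_apply (u v : p.Idx) :
    p.J u v = if u.1 = v.1 ∧ (u.2 : ℕ) = v.2 then p.eig u.1
      else if u.1 = v.1 ∧ (u.2 : ℕ) + 1 = v.2 then 1 else 0 := by
  obtain ⟨i, a⟩ := u
  obtain ⟨j, b⟩ := v
  by_cases h : i = j
  · subst h
    simp [J, jordanBlock, Fin.ext_iff]
  · simp [J, Matrix.blockDiagonal'_apply_ne _ _ _ h, h]

theorem J_mul_apply (M : Matrix p.Idx κ ℂ) (i : Fin p.r) (a : ℕ) (ha : a < p.size i) (w : κ) :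
    (p.J * M) ⟨i, ⟨a, ha⟩⟩ w = p.eig i * M ⟨i, ⟨a, ha⟩⟩ w +
      if h : a + 1 < p.size i then M ⟨i, ⟨a + 1, h⟩⟩ w else 0 := by
  have hsplit : ∀ v : p.Idx, p.J ⟨i, ⟨a, ha⟩⟩ v =
      (if (⟨i, ⟨a, ha⟩⟩ : p.Idx) = v then p.eig i else 0) +
        if i = v.1 ∧ a + 1 = v.2 then 1 else 0 := by
    rintro ⟨j, ⟨b, hb⟩⟩
    rw [J_apply]
    by_cases h : i = j
    · subst h
      by_cases h' : a = b
      · subst h'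
        simp
      · simp [h']
    · simp [h]
  rw [Matrix.mul_apply]
  simp only [hsplit, add_mul, Finset.sum_add_distrib]
  congr 1
  · simp
  · split_ifs with h
    · rw [Finset.sum_eq_single ⟨i, ⟨a + 1, h⟩⟩]
      · simp
      · rintro ⟨j, ⟨b, hb⟩⟩ - hne
        have : ¬ (i = j ∧ a + 1 = b) := by
          rintro ⟨rfl, rfl⟩
          exact hne rfl
        simp [this]
      · simp
    · refine Finset.sum_eq_zero ?_
      rintro ⟨j, ⟨b, hb⟩⟩ -
      have : ¬ (i = j ∧ a + 1 = b) := by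
        rintro ⟨rfl, rfl⟩
        exact h hb
      simp [this]

theorem mul_J_apply (M : Matrix κ p.Idx ℂ) (u : κ) (j : Fin p.r) (b : ℕ) (hb : b < p.size j) :
    (M * p.J) u ⟨j, ⟨b, hb⟩⟩ = p.eig j * M u ⟨j, ⟨b, hb⟩⟩ +
      if 0 < b then M u ⟨j, ⟨b - 1, (Nat.sub_le b 1).trans_lt hb⟩⟩ else 0 := by
  have hsplit : ∀ v : p.Idx, p.J v ⟨j, ⟨b, hb⟩⟩ =
      (if v = (⟨j, ⟨b, hb⟩⟩ : p.Idx) then p.eig j else 0) +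
        if v.1 = j ∧ (v.2 : ℕ) + 1 = b then 1 else 0 := by
    rintro ⟨i, ⟨a, ha⟩⟩
    rw [J_apply]
    by_cases h : i = j
    · subst h
      by_cases h' : a = b
      · subst h'
        simp
      · simp [h']
    · simp [h]
  rw [Matrix.mul_apply]
  simp only [hsplit, mul_add, Finset.sum_add_distrib]
  congr 1
  · simp [mul_comm]
  · split_ifs with h
    · rw [Finset.sum_eq_single ⟨j, ⟨b - 1, (Nat.sub_le b 1).trans_lt hb⟩⟩]
      · have : b - 1 + 1 = b := by omega
        simp [this]
      · rintro ⟨i, ⟨a, ha⟩⟩ - hne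
        have : ¬ (i = j ∧ a + 1 = b) := by
          rintro ⟨rfl, rfl⟩
          exact hne rfl
        simp [this]
      · simp
    · refine Finset.sum_eq_zero ?_
      rintro ⟨i, ⟨a, ha⟩⟩ -
      have : ¬ a + 1 = b := by omega
      simp [this]

theorem A_apply (i j : Fin p.r) (a b : ℕ) (ha : a < p.size i) (hb : b < p.size j) :
    p.A ⟨i, ⟨a, ha⟩⟩ ⟨j, ⟨b, hb⟩⟩ =
      if h : a + (p.size j - p.size i) ≤ b then
        p.toep i j ⟨b - (a + (p.size j - p.size i)), by omega⟩ else 0 := rfl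

theorem A_apply_eq_zero {i j : Fin p.r} (h : p.eig i ≠ p.eig j) (a : Fin (p.size i))
    (b : Fin (p.size j)) : p.A ⟨i, a⟩ ⟨j, b⟩ = 0 := by
  obtain ⟨a, ha⟩ := a
  obtain ⟨b, hb⟩ := b
  rw [A_apply]
  split_ifs
  · rw [p.toep_eq_zero i j h, Pi.zero_apply]
  · rfl

theorem commute_J_A : Commute p.J p.A := by
  change p.J * p.A = p.A * p.J
  ext ⟨i, ⟨a, ha⟩⟩ ⟨j, ⟨b, hb⟩⟩
  rw [J_mul_apply, mul_J_apply]
  by_cases h : p.eig i = p.eig j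
  · rw [h]
    congr 1
    simp only [A_apply]
    split_ifs <;> first | rfl | omega | (congr 2; omega)
  · simp [A_apply_eq_zero p h]

/-- The difference of the eigenvalues times an entry is the left neighbour minus the lower
neighbour; induction starts from the lower left corner of the block. -/
theorem eq_zero_of_commute_J {M : Matrix p.Idx p.Idx ℂ} (hM : Commute p.J M) {i j : Fin p.r}
    (hij : p.eig i ≠ p.eig j) (d : ℕ) : ∀ (a b : ℕ) (ha : a < p.size i) (hb : b < p.size j),
      p.size i - a + b = d → M ⟨i, ⟨a, ha⟩⟩ ⟨j, ⟨b, hb⟩⟩ = 0 := by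
  induction d using Nat.strong_induction_on with
  | _ d ih =>
    intro a b ha hb hd
    have e := congrFun (congrFun hM.eq ⟨i, ⟨a, ha⟩⟩) ⟨j, ⟨b, hb⟩⟩
    rw [J_mul_apply, mul_J_apply] at e
    have h1 : (if h : a + 1 < p.size i then M ⟨i, ⟨a + 1, h⟩⟩ ⟨j, ⟨b, hb⟩⟩ else 0) = 0 := by
      split_ifs with h
      · exact ih _ (by omega) _ _ _ _ rfl
      · rfl
    have h2 : (if 0 < b then M ⟨i, ⟨a, ha⟩⟩ ⟨j, ⟨b - 1, (Nat.sub_le b 1).trans_lt hb⟩⟩ else 0)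
        = 0 := by
      split_ifs with h
      · exact ih _ (by omega) _ _ _ _ rfl
      · rfl
    rw [h1, h2, add_zero, add_zero, ← sub_eq_zero, ← sub_mul] at e
    exact (mul_eq_zero.1 e).resolve_left (sub_ne_zero.2 hij)

theorem commute_J_shift {M : Matrix p.Idx p.Idx ℂ} (hM : Commute p.J M) {i j : Fin p.r}
    (hij : p.eig i = p.eig j) (a b : ℕ) (ha : a < p.size i) (hb : b < p.size j) :
    (if h : a + 1 < p.size i then M ⟨i, ⟨a + 1, h⟩⟩ ⟨j, ⟨b, hb⟩⟩ else 0) =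
      if 0 < b then M ⟨i, ⟨a, ha⟩⟩ ⟨j, ⟨b - 1, (Nat.sub_le b 1).trans_lt hb⟩⟩ else 0 := by
  have e := congrFun (congrFun hM.eq ⟨i, ⟨a, ha⟩⟩) ⟨j, ⟨b, hb⟩⟩
  rw [J_mul_apply, mul_J_apply, hij] at e
  exact add_left_cancel e

theorem apply_eq_of_commute_J {M : Matrix p.Idx p.Idx ℂ} (hM : Commute p.J M) {i j : Fin p.r}
    (hij : p.eig i = p.eig j) (k : ℕ) : ∀ (a b : ℕ) (ha : a + k < p.size i) (hb : b + k < p.size j),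
      M ⟨i, ⟨a + k, ha⟩⟩ ⟨j, ⟨b + k, hb⟩⟩ =
        M ⟨i, ⟨a, by omega⟩⟩ ⟨j, ⟨b, by omega⟩⟩ := by
  induction k with
  | zero => intro a b ha hb; rfl
  | succ k ih =>
    intro a b ha hb
    rw [← ih a b (by omega) (by omega)]
    have e := p.commute_J_shift hM hij (a + k) (b + k + 1) (by omega) hb
    rw [dif_pos (show a + k + 1 < p.size i from ha), if_pos (Nat.succ_pos _)] at e
    exact e

/-- Entries are constant along diagonals. If b < a, the diagonal is followed up to column 0 below
the first row; otherwise down to the last row before the last column. At both ends `commute_J_shift`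
equates the entry with one outside the block. -/
theorem apply_eq_zero_of_commute_J {M : Matrix p.Idx p.Idx ℂ} (hM : Commute p.J M)
    {i j : Fin p.r} (hij : p.eig i = p.eig j) (a b : ℕ) (ha : a < p.size i) (hb : b < p.size j)
    (hab : b < a + (p.size j - p.size i)) : M ⟨i, ⟨a, ha⟩⟩ ⟨j, ⟨b, hb⟩⟩ = 0 := by
  by_cases h : b < a
  · have e := p.commute_J_shift hM hij (a - b - 1) 0 (by omega) (by omega)
    rw [dif_pos (by omega), if_neg (lt_irrefl 0)] at e
    have e' := p.apply_eq_of_commute_J hM hij b (a - b - 1 + 1) 0 (by omega) (by omega)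
    rw [e] at e'
    convert e' using 4
    all_goals omega
  · have e := p.commute_J_shift hM hij (p.size i - 1) (b + (p.size i - 1 - a) + 1) (by omega)
      (by omega)
    rw [dif_neg (by omega), if_pos (Nat.succ_pos _)] at e
    have e' := p.apply_eq_of_commute_J hM hij (p.size i - 1 - a) a b (by omega) (by omega)
    rw [← e']
    refine Eq.trans ?_ e.symm
    congr 3
    omega

end EJAParams

/-- Once A₂ is in Jordan form, the transported A₃ lies in the centralizer, whose blocks are
determined by their first rows. -/
theorem exists_isEJAForm {ι : Type} [Fintype ι] [DecidableEq ι] {A₂ A₃ : Matrix ι ι ℂ}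
    (h : Commute A₂ A₃) : ∃ p : EJAParams, IsEJAForm A₂ A₃ p := by
  obtain ⟨r, size, eig, hpos, hsim⟩ := exists_simSimilar_jordanMatrix_fin A₂
  obtain ⟨P, R, h1, h2, h3⟩ := hsim
  have hJ : P * A₂ * R = jordanMatrix size eig := h3 0
  let p₀ : EJAParams := ⟨r, size, hpos, eig, 0, by simp⟩
  have hJ0 : p₀.J = jordanMatrix size eig := rfl
  have hcomm : Commute p₀.J (P * A₃ * R) := by
    rw [hJ0, ← hJ]
    change P * A₂ * R * (P * A₃ * R) = P * A₃ * R * (P * A₂ * R)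
    have : ∀ X Y : Matrix ι ι ℂ, P * X * R * (P * Y * R) = P * (X * Y) * R := by
      intro X Y
      calc P * X * R * (P * Y * R) = P * X * (R * P) * (Y * R) := by simp only [Matrix.mul_assoc]
        _ = _ := by rw [h2, Matrix.mul_one]; simp only [Matrix.mul_assoc]
    rw [this, this, h.eq]
  set M := P * A₃ * R with hM
  let p : EJAParams := ⟨r, size, hpos, eig, fun i j k =>
    M ⟨i, ⟨0, hpos i⟩⟩ ⟨j, ⟨k + (size j - size i), by omega⟩⟩, by
      intro i j hij
      funext k
      exact p₀.eq_zero_of_commute_J hcomm hij _ _ _ _ _ rfl⟩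
  refine ⟨p, P, R, h1, h2, fun j => ?_⟩
  fin_cases j
  · exact hJ
  · change M = p.A
    ext ⟨i, ⟨a, ha⟩⟩ ⟨j, ⟨b, hb⟩⟩
    by_cases hij : eig i = eig j
    · rw [p.A_apply]
      split_ifs with hab
      · change a + (size j - size i) ≤ b at hab
        have e := p₀.apply_eq_of_commute_J hcomm hij a 0 (b - a) (by simpa using ha)
          (show b - a + a < size j by omega)
        refine Eq.trans ?_ (e.trans ?_)
        · congr 3 <;> omega
        · simp only [p]
          congr 3
          omega
      · exact p₀.apply_eq_zero_of_commute_J hcomm hij a b ha hb (by simpa using hab)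
    · rw [p.A_apply_eq_zero hij]
      exact p₀.eq_zero_of_commute_J hcomm hij _ a b ha hb rfl

/-! ### Canonical forms of states and their symmetry -/

section CanonicalForms

variable {l N : ℕ}

theorem NoIdentitySummand.of_pqEquiv {m m' : ℕ} {B : Fin (l + 1) → Matrix (Fin m) (Fin m) ℂ}
    {B' : Fin (l + 1) → Matrix (Fin m') (Fin m') ℂ} (h : NoIdentitySummand B)
    (h' : PQEquiv B B') : NoIdentitySummand B' := by
  rintro ⟨n, k, γ, D, hn, hD⟩
  exact h ⟨n, k, γ, D, hn, h'.trans hD⟩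

theorem pqEquiv_emptySum {m : ℕ} (γ : Fin l → Matrix (Fin 0) (Fin 0) ℂ)
    (D : Fin (l + 1) → Matrix (Fin m) (Fin m) ℂ) :
    PQEquiv D (tupleSum (consTuple 1 γ) D) := by
  convert pqEquiv_submatrix D (Equiv.emptySum (Fin 0) (Fin m)) using 1
  funext j
  ext u v
  rcases u with u | u
  · exact u.elim0
  rcases v with v | v
  · exact v.elim0
  rfl

theorem exists_pqEquiv_consTuple_add {n n' : ℕ} (γ : Fin l → Matrix (Fin n) (Fin n) ℂ)
    (γ' : Fin l → Matrix (Fin n') (Fin n') ℂ) :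
    ∃ γ'' : Fin l → Matrix (Fin (n + n')) (Fin (n + n')) ℂ,
      PQEquiv (tupleSum (consTuple 1 γ) (consTuple 1 γ')) (consTuple 1 γ'') := by
  refine ⟨fun j => (Matrix.fromBlocks (γ j) 0 0 (γ' j)).submatrix finSumFinEquiv.symm
    finSumFinEquiv.symm, ?_⟩
  convert pqEquiv_submatrix _ finSumFinEquiv.symm using 1
  funext j
  refine Fin.cases ?_ (fun j => rfl) j
  simp [consTuple, tupleSum]

/-- An identity summand of maximal size n is split off; a further one in the rest could be merged
with it, contradicting maximality. -/
theorem exists_isCanonicalForm (Γ : Fin (l + 1) → Matrix (Fin N) (Fin N) ℂ) :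
    ∃ c : CanonicalData l, IsCanonicalForm Γ c := by
  obtain ⟨T, hT, hmax⟩ := exists_isILO_firstHasMaxRank Γ
  let S : Set ℕ := {n | ∃ (m : ℕ) (γ : Fin l → Matrix (Fin n) (Fin n) ℂ)
    (D : Fin (l + 1) → Matrix (Fin m) (Fin m) ℂ),
      PQEquiv (applyT T Γ) (tupleSum (consTuple 1 γ) D)}
  have hfin : S.Finite := (Set.finite_Iic N).subset (by
    rintro n ⟨m, γ, D, h⟩
    have := h.card_eq
    simp only [Fintype.card_sum, Fintype.card_fin] at this
    exact Set.mem_Iic.2 (by omega))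
  obtain ⟨n, ⟨m, γ, D, h⟩, hn⟩ := hfin.exists_maximal ⟨0, N, fun _ => 1, _, pqEquiv_emptySum _ _⟩
  have hD : NoIdentitySummand D := by
    rintro ⟨n', m', γ', D', hn', hD'⟩
    obtain ⟨γ'', hγ''⟩ := exists_pqEquiv_consTuple_add γ γ'
    have hmem : n + n' ∈ S := ⟨m', γ'', D', h.trans (((PQEquiv.refl _).tupleSum hD').trans
      ((tupleSum_assoc _ _ _).trans (hγ''.tupleSum (PQEquiv.refl _))))⟩
    have := hn hmem (Nat.le_add_right n n')
    omega
  obtain ⟨β, hβ⟩ := exists_pqEquiv_lambdaPrime D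
  obtain ⟨p, hp⟩ := exists_isEJAForm (commute_pairX_pairY γ)
  exact ⟨⟨n, m, m - (D 0).rank, Nat.sub_le _ _, p, β⟩, T, hT, hmax, γ,
    h.trans ((PQEquiv.refl _).tupleSum hβ), hD.of_pqEquiv hβ, hp⟩

theorem rank_tupleSum_consTuple {n m : ℕ} (γ : Fin l → Matrix (Fin n) (Fin n) ℂ)
    (B : Fin (l + 1) → Matrix (Fin m) (Fin m) ℂ) :
    (tupleSum (consTuple 1 γ) B 0).rank = n + (B 0).rank := by
  rw [tupleSum, rank_fromBlocks_diagonal]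
  simp [consTuple]

theorem CanonicalData.betaTuple_zero (c : CanonicalData l) :
    c.betaTuple 0 = lambdaPrime c.m c.i := rfl

theorem IsCanonicalForm.add_eq {Γ : Fin (l + 1) → Matrix (Fin N) (Fin N) ℂ} {c : CanonicalData l}
    (h : IsCanonicalForm Γ c) : c.n + c.m = N := by
  obtain ⟨T, -, -, γ, h, -, -⟩ := h
  have := h.card_eq
  simp only [Fintype.card_sum, Fintype.card_fin] at this
  omega

theorem IsCanonicalForm.firstHasMaxRank_betaTuple {Γ : Fin (l + 1) → Matrix (Fin N) (Fin N) ℂ}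
    {c : CanonicalData l} (h : IsCanonicalForm Γ c) : FirstHasMaxRank c.betaTuple := by
  obtain ⟨T, -, hmax, γ, h, -, -⟩ := h
  exact (hmax.of_pqEquiv h).tupleSum.2

theorem isGreatest_rank_of_firstHasMaxRank {T : Matrix (Fin (l + 1)) (Fin (l + 1)) ℂ}
    (hT : IsILO T) {Γ : Fin (l + 1) → Matrix (Fin N) (Fin N) ℂ}
    (hmax : FirstHasMaxRank (applyT T Γ)) :
    IsGreatest (Set.range fun t : Fin (l + 1) → ℂ => (∑ j, t j • Γ j).rank)
      (applyT T Γ 0).rank := by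
  refine ⟨⟨T 0, rfl⟩, ?_⟩
  rintro _ ⟨t, rfl⟩
  obtain ⟨S, h1, h2⟩ := hT
  have h3 := firstHasMaxRank_iff.1 hmax (Matrix.vecMul t S)
  rwa [linComb_applyT, Matrix.vecMul_vecMul, h2, Matrix.vecMul_one] at h3

theorem IsCanonicalForm.isGreatest_rank {Γ : Fin (l + 1) → Matrix (Fin N) (Fin N) ℂ}
    {c : CanonicalData l} (h : IsCanonicalForm Γ c) :
    IsGreatest (Set.range fun t : Fin (l + 1) → ℂ => (∑ j, t j • Γ j).rank) (N - c.i) := by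
  have hN := h.add_eq
  obtain ⟨T, hT, hmax, γ, h, -, -⟩ := h
  have h1 := isGreatest_rank_of_firstHasMaxRank hT hmax
  have h2 := h.rank_linComb (Pi.single 0 1)
  rw [linComb_single, linComb_single, rank_tupleSum_consTuple, c.betaTuple_zero,
    rank_lambdaPrime] at h2
  have h3 := c.i_le
  have h4 : N - c.i = (applyT T Γ 0).rank := by omega
  rwa [h4]

/-- For i = 0 the matrix Λ' is E, so the β-part would itself be an identity summand unless it is
empty. -/
theorem IsCanonicalForm.i_eq_zero_iff {Γ : Fin (l + 1) → Matrix (Fin N) (Fin N) ℂ}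
    {c : CanonicalData l} (h : IsCanonicalForm Γ c) : c.i = 0 ↔ c.m = 0 := by
  constructor
  · intro hi
    obtain ⟨T, -, -, γ, -, h, -⟩ := h
    by_contra hm
    refine h ⟨c.m, 0, c.β, fun _ => 1, Nat.pos_of_ne_zero hm, ?_⟩
    have e : c.betaTuple = consTuple 1 c.β := by
      rw [CanonicalData.betaTuple, hi, lambdaPrime_zero]
    rw [e]
    convert pqEquiv_submatrix (consTuple 1 c.β) (Equiv.sumEmpty (Fin c.m) (Fin 0)) using 1
    funext j
    ext u v
    rcases u with u | u
    · rcases v with v | v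
      · rfl
      · exact v.elim0
    · exact u.elim0
  · intro hm
    have := c.i_le
    omega

theorem linComb_cons (a : ℂ) (α : Fin l → ℂ) {ι : Type} (M : Matrix ι ι ℂ)
    (β : Fin l → Matrix ι ι ℂ) :
    linComb (Fin.cons a α) (consTuple M β) = a • M + ∑ j, α j • β j := by
  simp [linComb, consTuple, Fin.sum_univ_succ]

theorem IsCanonicalForm.isGreatest_rank_beta {Γ : Fin (l + 1) → Matrix (Fin N) (Fin N) ℂ}
    {c : CanonicalData l} (h : IsCanonicalForm Γ c) :
    IsGreatest (Set.range fun α : Fin l → ℂ =>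
      (lambdaPrime c.m c.i + ∑ j, α j • c.β j).rank) (c.m - c.i) := by
  constructor
  · exact ⟨0, by simp [rank_lambdaPrime]⟩
  · rintro _ ⟨α, rfl⟩
    have h1 := firstHasMaxRank_iff.1 h.firstHasMaxRank_betaTuple (Fin.cons 1 α)
    rwa [c.betaTuple_zero, rank_lambdaPrime, CanonicalData.betaTuple, linComb_cons, one_smul] at h1

theorem Matrix.eq_zero_of_rank_eq_zero {ι : Type} [Fintype ι] [DecidableEq ι] {M : Matrix ι ι ℂ}
    (h : M.rank = 0) : M = 0 := by
  rw [Matrix.rank, Submodule.finrank_eq_zero, LinearMap.range_eq_bot] at h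
  ext i j
  have := congrFun (LinearMap.congr_fun h (Pi.single j 1)) i
  simpa using this

/-- If i = m, the maximum rank in the β-part is 0, so every β vanishes. -/
theorem IsCanonicalForm.i_lt {Γ : Fin (l + 1) → Matrix (Fin N) (Fin N) ℂ}
    {c : CanonicalData l} (h : IsCanonicalForm Γ c) (hβ : ∃ j, c.β j ≠ 0) : c.i < c.m := by
  obtain ⟨j, hj⟩ := hβ
  by_contra hlt
  refine hj (Matrix.eq_zero_of_rank_eq_zero ?_)
  have h1 := firstHasMaxRank_iff.1 h.firstHasMaxRank_betaTuple (Pi.single j.succ 1)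
  rw [c.betaTuple_zero, rank_lambdaPrime, linComb_single] at h1
  have : (c.β j).rank ≤ c.m - c.i := h1
  omega

theorem PQEquiv.exists_mulVec {ι κ : Type} [Fintype ι] [DecidableEq ι] [Fintype κ] [DecidableEq κ]
    {Γ : Fin l → Matrix ι ι ℂ} {Γ' : Fin l → Matrix κ κ ℂ} (h : PQEquiv Γ Γ') {v : κ → ℂ}
    (hv : v ≠ 0) (hΓ : ∀ j, (Γ' j).mulVec v = 0) : ∃ w ≠ 0, ∀ j, (Γ j).mulVec w = 0 := by
  obtain ⟨P, Q, ⟨P', hP1, hP2⟩, ⟨Q', hQ1, hQ2⟩, h⟩ := h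
  refine ⟨Q.mulVec v, fun h0 => hv ?_, fun j => ?_⟩
  · have := congrArg Q'.mulVec h0
    simpa [Matrix.mulVec_mulVec, hQ2] using this
  · have := congrArg P'.mulVec (hΓ j)
    simpa [← h j, ← Matrix.mul_assoc, Matrix.mulVec_mulVec, hP2] using this

theorem PQEquiv.transpose {ι κ : Type} [Fintype ι] [DecidableEq ι] [Fintype κ] [DecidableEq κ]
    {Γ : Fin l → Matrix ι ι ℂ} {Γ' : Fin l → Matrix κ κ ℂ} (h : PQEquiv Γ Γ') :
    PQEquiv (fun j => (Γ j).transpose) (fun j => (Γ' j).transpose) := by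
  obtain ⟨P, Q, ⟨P', hP1, hP2⟩, ⟨Q', hQ1, hQ2⟩, h⟩ := h
  refine ⟨Q.transpose, P.transpose,
    ⟨Q'.transpose, by rw [← Matrix.transpose_mul, hQ2, Matrix.transpose_one],
      by rw [← Matrix.transpose_mul, hQ1, Matrix.transpose_one]⟩,
    ⟨P'.transpose, by rw [← Matrix.transpose_mul, hP2, Matrix.transpose_one],
      by rw [← Matrix.transpose_mul, hP1, Matrix.transpose_one]⟩, fun j => ?_⟩
  change _ = (Γ' j).transpose
  rw [← h j]
  simp only [Matrix.transpose_mul, Matrix.mul_assoc]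

theorem mulVec_eq_zero_of_applyT {ι : Type} [Fintype ι] [DecidableEq ι]
    {T : Matrix (Fin l) (Fin l) ℂ} (hT : IsILO T) {Γ : Fin l → Matrix ι ι ℂ} {w : ι → ℂ}
    (h : ∀ j, (applyT T Γ j).mulVec w = 0) (j : Fin l) : (Γ j).mulVec w = 0 := by
  obtain ⟨S, -, h2⟩ := hT
  rw [← applyT_one Γ, ← h2, ← applyT_applyT, applyT_eq_linComb, linComb, Matrix.sum_mulVec]
  exact Finset.sum_eq_zero fun k _ => by rw [Matrix.smul_mulVec, h, smul_zero]

theorem IsCanonicalForm.exists_beta_ne_zero {Γ : Fin (l + 1) → Matrix (Fin N) (Fin N) ℂ}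
    {c : CanonicalData l} (h : IsCanonicalForm Γ c)
    (hΓ : (∀ v : Fin N → ℂ, (∀ j, Matrix.mulVec (Γ j) v = 0) → v = 0) ∨
      (∀ v : Fin N → ℂ, (∀ j, Matrix.vecMul v (Γ j) = 0) → v = 0))
    (hi : 0 < c.i) : ∃ j, c.β j ≠ 0 := by
  by_contra! hβ
  have him := c.i_le
  obtain ⟨T, hT, -, γ, h, -, -⟩ := h
  -- Since i > 0, the last diagonal entry of Λ' is 0; with all β zero this basis vector is a common
  -- null vector on both sides.
  let v : Fin c.n ⊕ Fin c.m → ℂ := Pi.single (Sum.inr ⟨c.m - 1, by omega⟩) 1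
  have hv : v ≠ 0 := by simp [v]
  have hsymm : ∀ j, (tupleSum (consTuple 1 γ) c.betaTuple j).col
        (Sum.inr ⟨c.m - 1, by omega⟩) = 0 ∧
      (tupleSum (consTuple 1 γ) c.betaTuple j).row (Sum.inr ⟨c.m - 1, by omega⟩) = 0 := by
    have hlt : ¬ c.m - 1 < c.m - c.i := by omega
    intro j
    refine Fin.cases ?_ (fun j => ?_) j
    · constructor <;> funext u <;> rcases u with u | u <;>
        simp [tupleSum, c.betaTuple_zero, lambdaPrime, Matrix.diagonal_apply]
      · rintro rfl
        simp only
        omega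
      · rintro rfl
        omega
    · constructor <;> funext u <;> rcases u with u | u <;>
        simp [tupleSum, CanonicalData.betaTuple, consTuple, hβ]
  rcases hΓ with hΓ | hΓ
  · obtain ⟨w, hw, hw'⟩ := h.exists_mulVec hv fun j => by
      rw [Matrix.mulVec_single_one]
      exact (hsymm j).1
    exact hw (hΓ w (mulVec_eq_zero_of_applyT hT hw'))
  · obtain ⟨w, hw, hw'⟩ := h.transpose.exists_mulVec hv fun j => by
      rw [Matrix.mulVec_single_one]
      exact (hsymm j).2
    refine hw (hΓ w fun j => ?_)
    rw [← Matrix.mulVec_transpose]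
    refine mulVec_eq_zero_of_applyT hT (Γ := fun j => (Γ j).transpose) (fun k => ?_) j
    rw [← hw' k]
    congr 1
    simp [applyT, Matrix.transpose_sum]

theorem PQEquiv.isUnit_zero {ι κ : Type} [Fintype ι] [DecidableEq ι] [Fintype κ] [DecidableEq κ]
    {Γ : Fin (l + 1) → Matrix ι ι ℂ} {Γ' : Fin (l + 1) → Matrix κ κ ℂ} (h : PQEquiv Γ Γ')
    (h1 : IsUnit (Γ' 0)) : IsUnit (Γ 0) := by
  obtain ⟨P, Q, hP, hQ, h⟩ := h.symm
  rw [← h 0]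
  exact isILO_iff_isUnit.1 ((hP.mul (isILO_iff_isUnit.2 h1)).mul hQ)

theorem Matrix.isUnit_of_rank_eq {n : ℕ} {M : Matrix (Fin n) (Fin n) ℂ} (h : n ≤ M.rank) :
    IsUnit M := by
  obtain ⟨β, P, Q, hP, hQ, h1⟩ := exists_pqEquiv_lambdaPrime (l := 0) fun _ => M
  have h2 := h1 0
  have h3 : n - M.rank = 0 := by omega
  simp only [h3, lambdaPrime_zero, consTuple, Fin.cons_zero] at h2
  have h4 : PQEquiv (fun _ : Fin 1 => M) (fun _ => (1 : Matrix (Fin n) (Fin n) ℂ)) :=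
    ⟨P, Q, hP, hQ, fun _ => h2⟩
  exact h4.isUnit_zero isUnit_one

theorem NoIdentitySummand.not_isUnit {n m k : ℕ} {B : Fin (l + 1) → Matrix (Fin m) (Fin m) ℂ}
    (h : NoIdentitySummand B) {U : Fin (l + 1) → Matrix (Fin n) (Fin n) ℂ} (hn : 0 < n)
    {D : Fin (l + 1) → Matrix (Fin k) (Fin k) ℂ} (hB : PQEquiv B (tupleSum U D)) :
    ¬ IsUnit (U 0) := fun hU =>
  h ⟨n, k, _, D, hn,
    hB.trans ((pqEquiv_consTuple_one_of_isUnit hU).tupleSum (PQEquiv.refl _))⟩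

/-- Undoing S on a summand (E, δ) of SB gives a summand U of B. Some combination in U equals E, and
the first matrix of U has maximum rank, so it is invertible and U yields an identity summand of B
itself. -/
theorem NoIdentitySummand.applyT {m : ℕ} {B : Fin (l + 1) → Matrix (Fin m) (Fin m) ℂ}
    (h : NoIdentitySummand B) (hmax : FirstHasMaxRank B)
    {S : Matrix (Fin (l + 1)) (Fin (l + 1)) ℂ} (hS : IsILO S) :
    NoIdentitySummand (applyT S B) := by
  rintro ⟨n, k, δ, D, hn, hD⟩
  obtain ⟨R, h1, h2⟩ := hS
  have h3 := hD.of_applyT h2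
  rw [applyT_tupleSum] at h3
  refine h.not_isUnit hn h3 (Matrix.isUnit_of_rank_eq ?_)
  have h4 := firstHasMaxRank_iff.1 (hmax.of_pqEquiv h3).tupleSum.1 (S 0)
  rw [← applyT_eq_linComb, applyT_applyT, h1, applyT_one] at h4
  simpa [consTuple] using h4

theorem IsCanonicalForm.parametricSymmetry {Γ Γ' : Fin (l + 1) → Matrix (Fin N) (Fin N) ℂ}
    {c c' : CanonicalData l} (h : IsCanonicalForm Γ c) (h' : IsCanonicalForm Γ' c')
    (hS : SLOCCEquiv Γ Γ') : ParametricSymmetry c c' := by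
  have hβ := h.firstHasMaxRank_betaTuple
  obtain ⟨T, hT, hmax, γ, hγ, hno, hp⟩ := h
  obtain ⟨T', hT', hmax', γ', hγ', hno', hp'⟩ := h'
  obtain ⟨S, hS, hSγ⟩ : ∃ S : Matrix (Fin (l + 1)) (Fin (l + 1)) ℂ, IsILO S ∧
      PQEquiv (applyT S (tupleSum (consTuple 1 γ) c.betaTuple))
        (tupleSum (consTuple 1 γ') c'.betaTuple) := by
    apply sloccEquiv_iff.1
    exact (((sloccEquiv_applyT hT Γ).trans (.of_pqEquiv hγ)).symm.trans hS).trans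
      ((sloccEquiv_applyT hT' Γ').trans (.of_pqEquiv hγ'))
  have hW := hmax.of_pqEquiv hγ
  have hSW := (hmax'.of_pqEquiv hγ').of_pqEquiv hSγ.symm
  rw [applyT_tupleSum] at hSγ hSW
  -- Maximality after S gives n + rank Λ' ≤ rank G + rank (SB)₀, and maximality in the β-part gives
  -- rank (SB)₀ ≤ rank Λ'.
  have hGrank : c.n ≤ (applyT S (consTuple 1 γ) 0).rank := by
    obtain ⟨R, -, hRS⟩ := hS
    have h1 := firstHasMaxRank_iff.1 hSW (R 0)
    rw [← applyT_tupleSum, ← applyT_eq_linComb, applyT_applyT, hRS, applyT_one,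
      rank_tupleSum_consTuple, applyT_tupleSum, tupleSum, rank_fromBlocks_diagonal] at h1
    have h2 := firstHasMaxRank_iff.1 hβ (S 0)
    rw [← applyT_eq_linComb] at h2
    omega
  have hG : IsUnit (applyT S (consTuple 1 γ) 0) := Matrix.isUnit_of_rank_eq hGrank
  obtain ⟨hn, hsim, hPQ⟩ := pqEquiv_of_pqEquiv_tupleSum (hno.applyT hβ hS) hno'
    (((pqEquiv_renormalize hG).symm.tupleSum (PQEquiv.refl _)).trans hSγ)
  obtain ⟨n', m', i', hi', params', β'⟩ := c'
  obtain ⟨n, m, i, hi, params, β⟩ := c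
  simp only at hn
  subst hn
  exact ⟨rfl, S, γ, hS, hG, hp, (simSimilar_pair_of_simSimilar hsim).trans hp', hPQ⟩

/-- The parameters fix γ up to simultaneous similarity, so any γ realising them may replace the one
in the canonical form. -/
theorem IsCanonicalForm.sloccEquiv_of_isEJAForm {Γ : Fin (l + 1) → Matrix (Fin N) (Fin N) ℂ}
    {c : CanonicalData l} (h : IsCanonicalForm Γ c) {γ : Fin l → Matrix (Fin c.n) (Fin c.n) ℂ}
    (hγ : IsEJAForm (pairX l c.n) (pairY γ) c.params) :
    SLOCCEquiv Γ (tupleSum (consTuple 1 γ) c.betaTuple) := by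
  obtain ⟨T, hT, -, γ', h, -, hγ'⟩ := h
  refine (sloccEquiv_applyT hT Γ).trans (.of_pqEquiv (h.trans ?_))
  exact (pqEquiv_consTuple_one_iff.2 (simSimilar_of_simSimilar_pair
    (hγ'.trans hγ.symm))).tupleSum (PQEquiv.refl _)

theorem IsCanonicalForm.sloccEquiv {Γ Γ' : Fin (l + 1) → Matrix (Fin N) (Fin N) ℂ}
    {c c' : CanonicalData l} (h : IsCanonicalForm Γ c) (h' : IsCanonicalForm Γ' c')
    (hs : ParametricSymmetry c c') : SLOCCEquiv Γ Γ' := by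
  obtain ⟨n', m', i', hi', params', β'⟩ := c'
  obtain ⟨n, m, i, hi, params, β⟩ := c
  obtain ⟨hn, T, γ, hT, hG, hγ, hγ', hB⟩ := hs
  simp only at hn
  subst hn
  refine (h.sloccEquiv_of_isEJAForm hγ).trans (SLOCCEquiv.trans ?_
    (h'.sloccEquiv_of_isEJAForm hγ').symm)
  refine (sloccEquiv_applyT hT _).trans (.of_pqEquiv ?_)
  rw [applyT_tupleSum]
  exact (pqEquiv_renormalize hG).tupleSum hB

theorem exists_pqEquiv_triple {ι : Type} [Fintype ι] [DecidableEq ι] {Γ : Fin 3 → Matrix ι ι ℂ}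
    (h0 : IsUnit (Γ 0)) (h : Commute ((Γ 0)⁻¹ * Γ 1) ((Γ 0)⁻¹ * Γ 2)) :
    ∃ p : EJAParams, PQEquiv Γ ![1, p.J, p.A] := by
  obtain ⟨p, hp⟩ := exists_isEJAForm h
  refine ⟨p, (pqEquiv_consTuple_one_of_isUnit h0).trans ?_⟩
  refine (pqEquiv_consTuple_one_iff (γ' := ![p.J, p.A])).2 ?_
  have h1 : (fun j : Fin 2 => (Γ 0)⁻¹ * Γ j.succ) = ![(Γ 0)⁻¹ * Γ 1, (Γ 0)⁻¹ * Γ 2] := by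
    funext j
    fin_cases j <;> rfl
  rw [h1]
  exact hp

/-- Seen as SLOCC equivalence of the normal forms, the relation inherits symmetry, and arbitrary
states reduce to it by transitivity. -/
theorem tripleSymmetry_iff (p p' : EJAParams) :
    TripleSymmetry p p' ↔ SLOCCEquiv ![1, p.J, p.A] ![1, p'.J, p'.A] := by
  have hsim : ∀ T : Matrix (Fin 3) (Fin 3) ℂ, renormalize T ![p.J, p.A] =
      ![renormalize T ![p.J, p.A] 0, renormalize T ![p.J, p.A] 1] := by
    intro T
    funext j
    fin_cases j <;> rfl
  rw [sloccEquiv_iff]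
  constructor
  · rintro ⟨T, hT, hG, h⟩
    refine ⟨T, hT, (pqEquiv_renormalize (γ := ![p.J, p.A]) hG).trans ?_⟩
    refine (pqEquiv_consTuple_one_iff (γ' := ![p'.J, p'.A])).2 ?_
    rw [hsim]
    exact h
  · rintro ⟨T, hT, h⟩
    have hG : IsUnit (applyT T ![1, p.J, p.A] 0) := h.isUnit_zero isUnit_one
    refine ⟨T, hT, hG, ?_⟩
    have h1 := (pqEquiv_consTuple_one_iff (γ' := ![p'.J, p'.A])).1
      ((pqEquiv_renormalize (γ := ![p.J, p.A]) hG).symm.trans h)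
    rw [hsim] at h1
    exact h1

theorem sloccEquiv_iff_tripleSymmetry {Γ Γ' : Fin 3 → Matrix (Fin N) (Fin N) ℂ} {p p' : EJAParams}
    (h : PQEquiv Γ ![1, p.J, p.A]) (h' : PQEquiv Γ' ![1, p'.J, p'.A]) :
    SLOCCEquiv Γ Γ' ↔ TripleSymmetry p p' := by
  rw [tripleSymmetry_iff]
  exact ⟨fun hS => ((SLOCCEquiv.of_pqEquiv h).symm.trans hS).trans (.of_pqEquiv h'),
    fun hS => ((SLOCCEquiv.of_pqEquiv h).trans hS).trans (SLOCCEquiv.of_pqEquiv h').symm⟩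

end CanonicalForms

/-! ### Intertwiners of nilpotent Jordan blocks and substitution -/

section Blocks

open Polynomial

variable {n : ℕ}

theorem jordanBlock_zero_apply (p q : Fin n) :
    jordanBlock n 0 p q = if (p : ℕ) + 1 = q then 1 else 0 := by
  simpa using jordanBlock_zero_pow_apply 1 p q

theorem exists_aeval_jordanBlock_mul_eq_one {f : ℂ[X]} (hf : f.coeff 0 ≠ 0) (n : ℕ) :
    ∃ v : ℂ[X], aeval (jordanBlock n 0) f * aeval (jordanBlock n 0) v = 1 := by
  have hX : ¬ X ∣ f := by rwa [X_dvd_iff]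
  obtain ⟨u, v, huv⟩ : IsCoprime (X ^ n) f :=
    IsCoprime.pow_left ((irreducible_X.coprime_iff_not_dvd).2 hX)
  refine ⟨v, ?_⟩
  have h1 : aeval (jordanBlock n 0) (X ^ n : ℂ[X]) = 0 :=
    (aeval_jordanBlock_zero_eq_zero_iff _).2 dvd_rfl
  have h2 := congrArg (aeval (jordanBlock n 0)) huv
  rw [map_add, map_mul, map_mul, h1, mul_zero, zero_add, map_one] at h2
  rw [← map_mul, mul_comm, map_mul, h2]

theorem jordanBlock_zero_pow_self (n : ℕ) : jordanBlock n 0 ^ n = 0 := by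
  have := (aeval_jordanBlock_zero_eq_zero_iff (n := n) (X ^ n)).2 dvd_rfl
  rwa [map_pow, aeval_X] at this

/-- By hypothesis f₁ − lam·f₀ acts invertibly, so K = N'KW with N' the nilpotent block of size n'
and W a polynomial in the other block; iterating n' times gives K = 0. -/
theorem eq_zero_of_jordanBlock_intertwine {n n' : ℕ} {K : Matrix (Fin n') (Fin n) ℂ}
    {f₀ f₁ : ℂ[X]} {lam : ℂ}
    (h : K * aeval (jordanBlock n 0) f₁ =
      aeval (jordanBlock n' 0) (C lam + X) * (K * aeval (jordanBlock n 0) f₀))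
    (hne : f₁.coeff 0 ≠ lam * f₀.coeff 0) : K = 0 := by
  obtain ⟨v, hv⟩ := exists_aeval_jordanBlock_mul_eq_one (f := f₁ - C lam * f₀)
    (by simpa [sub_eq_zero] using hne) n
  have h1 : K * aeval (jordanBlock n 0) (f₁ - C lam * f₀) =
      jordanBlock n' 0 * (K * aeval (jordanBlock n 0) f₀) := by
    rw [map_sub, Matrix.mul_sub, h, map_add, aeval_X, Matrix.add_mul, map_mul, aeval_C, aeval_C]
    simp [Algebra.algebraMap_eq_smul_one]
  have h2 : K = jordanBlock n' 0 * K * (aeval (jordanBlock n 0) (f₀ * v)) := by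
    calc K = K * (aeval (jordanBlock n 0) (f₁ - C lam * f₀) * aeval (jordanBlock n 0) v) := by
          rw [hv, Matrix.mul_one]
      _ = _ := by rw [← Matrix.mul_assoc, h1, map_mul]; simp only [Matrix.mul_assoc]
  have h3 : ∀ k : ℕ, K = jordanBlock n' 0 ^ k * K * (aeval (jordanBlock n 0) (f₀ * v)) ^ k := by
    intro k
    induction k with
    | zero => simp
    | succ k ih =>
      conv_lhs => rw [ih, h2]
      rw [pow_succ, pow_succ']
      simp only [Matrix.mul_assoc]
  rw [h3 n', jordanBlock_zero_pow_self, Matrix.zero_mul, Matrix.zero_mul]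

/-- The last basis vector is cyclic, so a matrix in the commutant is determined by its last column,
and some polynomial has any prescribed last column. -/
theorem exists_eq_aeval_of_commute_jordanBlock {B : Matrix (Fin n) (Fin n) ℂ}
    (hB : Commute B (jordanBlock n 0)) : ∃ g : ℂ[X], B = aeval (jordanBlock n 0) g := by
  rcases Nat.eq_zero_or_pos n with rfl | hn
  · exact ⟨0, by ext i; exact i.elim0⟩
  let last : Fin n := ⟨n - 1, by omega⟩
  let g : ℂ[X] := ∑ k : Fin n, C (B k last) * X ^ (n - 1 - (k : ℕ))
  have hg : ∀ p, aeval (jordanBlock n 0) g p last = B p last := by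
    intro p
    have hp : p ≤ last := Fin.le_def.2 (by simp only [last]; omega)
    rw [aeval_jordanBlock_zero_apply, if_pos hp]
    simp only [g, finsetSum_coeff, coeff_C_mul, coeff_X_pow, last]
    rw [Finset.sum_eq_single p]
    · simp
    · intro q _ hq
      have : ¬ n - 1 - (p : ℕ) = n - 1 - q := fun h => hq (Fin.ext (by omega))
      simp [this]
    · simp
  have hcol : ∀ (M : Matrix (Fin n) (Fin n) ℂ) (p q : Fin n),
      (M * jordanBlock n 0 ^ (n - 1 - (q : ℕ))) p last = M p q := by
    intro M p q
    rw [Matrix.mul_apply, Finset.sum_eq_single q]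
    · have : (q : ℕ) + (n - 1 - q) = n - 1 := by omega
      simp [jordanBlock_zero_pow_apply, last, this]
    · intro v _ hv
      have : ¬ (v : ℕ) + (n - 1 - q) = n - 1 := fun h => hv (Fin.ext (by omega))
      simp [jordanBlock_zero_pow_apply, last, this]
    · simp
  have hgN : Commute (aeval (jordanBlock n 0) g) (jordanBlock n 0) := by
    have := (Commute.all g X).map (aeval (jordanBlock n 0))
    rwa [aeval_X] at this
  refine ⟨g, ?_⟩
  ext p q
  rw [← hcol B, ← hcol (aeval _ g), (hB.pow_right _).eq, (hgN.pow_right _).eq, Matrix.mul_apply,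
    Matrix.mul_apply]
  exact Finset.sum_congr rfl fun v _ => by rw [hg]

theorem aeval_conj {ι : Type} [Fintype ι] [DecidableEq ι] {K K' : Matrix ι ι ℂ} (h1 : K * K' = 1)
    (h2 : K' * K = 1) (M : Matrix ι ι ℂ) (f : ℂ[X]) : aeval (K * M * K') f = K * aeval M f * K' := by
  induction f using Polynomial.induction_on with
  | C a => simp [Algebra.algebraMap_eq_smul_one, h1]
  | add f g hf hg => rw [map_add, map_add, hf, hg, Matrix.mul_add, Matrix.add_mul]
  | monomial k a ih =>
    rw [pow_succ, ← mul_assoc, map_mul, map_mul _ _ X, ih, aeval_X, aeval_X]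
    calc K * aeval M (C a * X ^ k) * K' * (K * M * K')
        = K * aeval M (C a * X ^ k) * (K' * K) * (M * K') := by simp only [Matrix.mul_assoc]
      _ = _ := by rw [h2, Matrix.mul_one]; simp only [Matrix.mul_assoc]

/-- As f₀ is invertible modulo X^n, `h₁` says that lam + J is the conjugate of (f₁/f₀)(J) by K. So
KJK⁻¹ commutes with J and equals some g(J); then f(g(J)) = K f(J) K⁻¹ turns the two equations into
congruences. Nilpotency gives g(0) = 0, and g'(0) = 0 would give J^(n−1) = 0. -/
theorem exists_substitution_of_intertwine {n n' : ℕ} (hn : 0 < n) {K : Matrix (Fin n') (Fin n) ℂ}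
    {K' : Matrix (Fin n) (Fin n') ℂ} (hK : K * K' = 1) (hK' : K' * K = 1)
    {f₀ f₁ f₂ a : ℂ[X]} {lam : ℂ} (hf₀ : f₀.coeff 0 ≠ 0)
    (h₁ : K * aeval (jordanBlock n 0) f₁ =
      aeval (jordanBlock n' 0) (C lam + X) * (K * aeval (jordanBlock n 0) f₀))
    (h₂ : K * aeval (jordanBlock n 0) f₂ =
      aeval (jordanBlock n' 0) a * (K * aeval (jordanBlock n 0) f₀)) :
    n' = n ∧ ∃ g : ℂ[X], g.coeff 0 = 0 ∧ g.coeff 1 ≠ 0 ∧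
      X ^ n ∣ f₁.comp g - (C lam + X) * f₀.comp g ∧ X ^ n ∣ f₂.comp g - a * f₀.comp g := by
  obtain rfl : n' = n := by
    simpa using IsILO.card_eq ⟨K', hK, hK'⟩
  refine ⟨rfl, ?_⟩
  set J := jordanBlock n' 0 with hJ
  have hcomm : Commute (K * J * K') J := by
    obtain ⟨v, hv⟩ := exists_aeval_jordanBlock_mul_eq_one hf₀ n'
    have h3 : aeval J (C lam + X) = K * aeval J (f₁ * v) * K' := by
      calc aeval J (C lam + X)
          = aeval J (C lam + X) * (K * (aeval J f₀ * aeval J v) * K') := by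
            rw [hv, Matrix.mul_one, hK, Matrix.mul_one]
        _ = aeval J (C lam + X) * (K * aeval J f₀) * (aeval J v * K') := by
            simp only [Matrix.mul_assoc]
        _ = _ := by rw [← h₁, map_mul]; simp only [Matrix.mul_assoc]
    have h4 : Commute (K * J * K') (aeval J (C lam + X)) := by
      have h5 : aeval (K * J * K') (X : ℂ[X]) = K * J * K' := aeval_X _
      have h6 := (Commute.all X (f₁ * v)).map (aeval (K * J * K'))
      rwa [h5, aeval_conj hK hK' J (f₁ * v), ← h3] at h6
    rw [map_add, aeval_X, aeval_C] at h4
    have h6 := h4.sub_right (show Commute (K * J * K') (algebraMap ℂ _ lam) from (Algebra.commutes lam _).symm)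
    rwa [add_sub_cancel_left] at h6
  obtain ⟨g, hg, hg0, hg1⟩ : ∃ g : ℂ[X], K * J * K' = aeval J g ∧ g.coeff 0 = 0 ∧
      g.coeff 1 ≠ 0 := by
    obtain ⟨g, hg⟩ := exists_eq_aeval_of_commute_jordanBlock hcomm
    have hpow : ∀ k, aeval J (g ^ k) = K * J ^ k * K' := by
      intro k
      have := aeval_conj hK hK' J (X ^ k)
      rw [map_pow, map_pow, aeval_X, aeval_X] at this
      rw [← this, hg, map_pow]
    -- For size 1 the matrix g(J) does not determine g'(0), so g = X is chosen.
    by_cases h1 : n' = 1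
    · refine ⟨X, ?_, by simp, by simp⟩
      have hJ0 : J = 0 := by
        have := jordanBlock_zero_pow_self n'
        rwa [h1, pow_one, ← h1] at this
      rw [aeval_X, hJ0, Matrix.mul_zero, Matrix.zero_mul]
    · have h0 : X ∣ g := by
        have h2 := hpow n'
        rw [hJ, jordanBlock_zero_pow_self, Matrix.mul_zero, Matrix.zero_mul,
          aeval_jordanBlock_zero_eq_zero_iff] at h2
        exact prime_X.dvd_of_dvd_pow ((dvd_pow_self X hn.ne').trans h2)
      refine ⟨g, hg, X_dvd_iff.1 h0, fun hg1 => ?_⟩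
      have h2 : X ^ 2 ∣ g := by
        rw [X_pow_dvd_iff]
        intro d hd
        interval_cases d
        · exact X_dvd_iff.1 h0
        · exact hg1
      have h3 : aeval J (g ^ (n' - 1)) = 0 := by
        rw [aeval_jordanBlock_zero_eq_zero_iff]
        refine (pow_dvd_pow X (show n' ≤ 2 * (n' - 1) by omega)).trans ?_
        rw [pow_mul]
        exact pow_dvd_pow_of_dvd h2 _
      rw [hpow] at h3
      have h4 : J ^ (n' - 1) = 0 := by
        calc J ^ (n' - 1) = (K' * K) * J ^ (n' - 1) * (K' * K) := by simp [hK']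
          _ = K' * (K * J ^ (n' - 1) * K') * K := by simp only [Matrix.mul_assoc]
          _ = 0 := by rw [h3]; simp
      have h5 : aeval J (X ^ (n' - 1) : ℂ[X]) = 0 := by rw [map_pow, aeval_X, h4]
      rw [hJ, aeval_jordanBlock_zero_eq_zero_iff, X_pow_dvd_iff] at h5
      simpa using h5 (n' - 1) (by omega)
  have hcomp : ∀ f : ℂ[X], aeval J (f.comp g) = K * aeval J f * K' := by
    intro f
    rw [aeval_comp, ← hg, aeval_conj hK hK']
  refine ⟨g, hg0, hg1, ?_, ?_⟩
  · rw [← aeval_jordanBlock_zero_eq_zero_iff, ← hJ, map_sub, map_mul, hcomp, hcomp, h₁]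
    simp only [Matrix.mul_assoc, sub_self]
  · rw [← aeval_jordanBlock_zero_eq_zero_iff, ← hJ, map_sub, map_mul, hcomp, hcomp, h₂]
    simp only [Matrix.mul_assoc, sub_self]

/-- The columns of S form the Jordan chain of g(J) starting from the last basis vector. Since X
divides g exactly once, S is upper triangular with powers of g'(0) on the diagonal. -/
theorem exists_conj_jordanBlock {g : ℂ[X]} (h0 : g.coeff 0 = 0) (h1 : g.coeff 1 ≠ 0) (n : ℕ) :
    ∃ S : Matrix (Fin n) (Fin n) ℂ, IsUnit S ∧
      S * jordanBlock n 0 = aeval (jordanBlock n 0) g * S := by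
  rcases Nat.eq_zero_or_pos n with rfl | hn
  · exact ⟨1, isUnit_one, by ext i; exact i.elim0⟩
  set J := jordanBlock n 0 with hJ
  obtain ⟨h, hg⟩ := X_dvd_iff.2 h0
  rw [hg, coeff_X_mul] at h1
  let last : Fin n := ⟨n - 1, by omega⟩
  have hle : ∀ p : Fin n, p ≤ last := fun p => Fin.le_def.2 (by simp only [last]; omega)
  let S : Matrix (Fin n) (Fin n) ℂ := Matrix.of fun p q => aeval J (g ^ (n - 1 - (q : ℕ))) p last
  have hS : ∀ p q, S p q = (X ^ (n - 1 - (q : ℕ)) * h ^ (n - 1 - (q : ℕ))).coeff (n - 1 - p) := by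
    intro p q
    simp only [S, Matrix.of_apply]
    rw [hJ, aeval_jordanBlock_zero_apply, if_pos (hle p), hg, mul_pow]
  refine ⟨S, ?_, ?_⟩
  · rw [Matrix.isUnit_iff_isUnit_det, Matrix.det_of_isUpperTriangular, isUnit_iff_ne_zero]
    · refine Finset.prod_ne_zero_iff.2 fun p _ => ?_
      rw [hS, coeff_X_pow_mul', if_pos le_rfl, Nat.sub_self, coeff_zero_eq_eval_zero, eval_pow,
        ← coeff_zero_eq_eval_zero]
      exact pow_ne_zero _ h1
    · intro p q hpq
      have : (q : ℕ) < p := hpq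
      rw [hS, coeff_X_pow_mul', if_neg (by omega)]
  · ext p q
    have hr : (aeval J g * S) p q = aeval J (g ^ (n - 1 - (q : ℕ) + 1)) p last := by
      rw [pow_succ', map_mul, Matrix.mul_apply, Matrix.mul_apply]
      rfl
    have hl : (S * J) p q = if h : 0 < (q : ℕ) then S p ⟨q - 1, by omega⟩ else 0 := by
      rw [Matrix.mul_apply]
      split_ifs with hq
      · rw [Finset.sum_eq_single ⟨q - 1, by omega⟩]
        · have : (q : ℕ) - 1 + 1 = q := by omega
          simp [J, jordanBlock_zero_apply, this]
        · intro v _ hv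
          have : ¬ (v : ℕ) + 1 = q := fun h => hv (Fin.ext (by simp only; omega))
          simp [J, jordanBlock_zero_apply, this]
        · simp
      · refine Finset.sum_eq_zero fun v _ => ?_
        have : ¬ (v : ℕ) + 1 = q := by omega
        simp [J, jordanBlock_zero_apply, this]
    rw [hl, hr]
    split_ifs with hq
    · simp only [S, Matrix.of_apply]
      have hq' : n - 1 - ((q : ℕ) - 1) = n - 1 - q + 1 := by
        have := q.isLt
        omega
      rw [hq']
    -- Column 0 ends the chain: X^n divides g^n, so g(J)^n = 0.
    · have hq0 : n - 1 - (q : ℕ) + 1 = n := by omega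
      rw [hq0, (aeval_jordanBlock_zero_eq_zero_iff _).2, Matrix.zero_apply]
      rw [hg, mul_pow]
      exact dvd_mul_right _ _

end Blocks

/-! ### The explicit symmetry for distinct eigenvalues -/

section ExplicitSymmetry

open Polynomial

/-- The first equation forces Q to be the inverse of PΓ₀; eliminating it leaves inverse-free
equations in P alone. -/
theorem pqEquiv_triple_iff {ι κ : Type} [Fintype ι] [DecidableEq ι] [Fintype κ] [DecidableEq κ]
    {Γ : Fin 3 → Matrix ι ι ℂ} {B C : Matrix κ κ ℂ} :
    PQEquiv Γ ![1, B, C] ↔ IsUnit (Γ 0) ∧ ∃ P : Matrix κ ι ℂ, IsILO P ∧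
      P * Γ 1 = B * (P * Γ 0) ∧ P * Γ 2 = C * (P * Γ 0) := by
  constructor
  · intro h
    refine ⟨h.isUnit_zero isUnit_one, ?_⟩
    obtain ⟨P, Q, hP, ⟨R, h1, h2⟩, h⟩ := h
    have h3 : ∀ j, P * Γ j = (![1, B, C] : Fin 3 → Matrix κ κ ℂ) j * R := by
      intro j
      rw [← h, Matrix.mul_assoc, h1, Matrix.mul_one]
    have h4 : P * Γ 0 = R := by simpa using h3 0
    exact ⟨P, hP, by rw [h4]; exact h3 1, by rw [h4]; exact h3 2⟩
  · rintro ⟨h0, P, hP, h1, h2⟩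
    obtain ⟨R, hR1, hR2⟩ := hP.mul (isILO_iff_isUnit.2 h0)
    refine ⟨P, R, hP, ⟨_, hR2, hR1⟩, fun j => ?_⟩
    fin_cases j
    · exact hR1
    · change P * Γ 1 * R = B
      rw [h1, Matrix.mul_assoc, hR1, Matrix.mul_one]
    · change P * Γ 2 * R = C
      rw [h2, Matrix.mul_assoc, hR1, Matrix.mul_one]

theorem tripleSymmetry_iff_exists (p p' : EJAParams) :
    TripleSymmetry p p' ↔ ∃ T : Matrix (Fin 3) (Fin 3) ℂ, IsILO T ∧
      IsUnit (applyT T ![1, p.J, p.A] 0) ∧ ∃ P : Matrix p'.Idx p.Idx ℂ, IsILO P ∧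
        P * applyT T ![1, p.J, p.A] 1 = p'.J * (P * applyT T ![1, p.J, p.A] 0) ∧
        P * applyT T ![1, p.J, p.A] 2 = p'.A * (P * applyT T ![1, p.J, p.A] 0) := by
  simp only [tripleSymmetry_iff, sloccEquiv_iff, pqEquiv_triple_iff]

theorem aeval_jordanBlock_C_add_X (n : ℕ) (lam : ℂ) :
    aeval (jordanBlock n 0) (C lam + X) = jordanBlock n lam := by
  rw [map_add, aeval_C, aeval_X, add_comm, jordanBlock_eq_add n lam]

namespace EJAParams

variable {p : EJAParams}

theorem coeff_blockPoly (i : Fin p.r) (k : ℕ) : (p.blockPoly i).coeff k =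
    if h : k < min (p.size i) (p.size i) then p.toep i i ⟨k, h⟩ else 0 := by
  rw [blockPoly, finsetSum_coeff]
  simp only [coeff_monomial]
  split_ifs with h
  · rw [Finset.sum_eq_single ⟨k, h⟩]
    · simp
    · intro j _ hj
      have : ¬ (j : ℕ) = k := fun h => hj (Fin.ext h)
      simp [this]
    · simp
  · refine Finset.sum_eq_zero fun j _ => ?_
    have : ¬ (j : ℕ) = k := by omega
    simp [this]

theorem A_apply_self (i : Fin p.r) (a b : Fin (p.size i)) :
    p.A ⟨i, a⟩ ⟨i, b⟩ = aeval (jordanBlock (p.size i) 0) (p.blockPoly i) a b := by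
  obtain ⟨a, ha⟩ := a
  obtain ⟨b, hb⟩ := b
  rw [A_apply, aeval_jordanBlock_zero_apply]
  by_cases h : a ≤ b
  · rw [dif_pos (by omega), if_pos (Fin.le_def.2 h), coeff_blockPoly, dif_pos (by simp only; omega)]
    have hs : b - (a + (p.size i - p.size i)) = b - a := by omega
    simp only [hs]
  · rw [dif_neg (by omega), if_neg (fun h' => h (Fin.le_def.1 h'))]

theorem J_eq_blockDiagonal' : p.J = Matrix.blockDiagonal' fun i =>
    aeval (jordanBlock (p.size i) 0) (C (p.eig i) + X) := by
  simp only [aeval_jordanBlock_C_add_X]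
  rfl

theorem Nonderogatory.A_eq_blockDiagonal' (hp : p.Nonderogatory) :
    p.A = Matrix.blockDiagonal' fun i => aeval (jordanBlock (p.size i) 0) (p.blockPoly i) := by
  ext ⟨i, a⟩ ⟨j, b⟩
  by_cases h : i = j
  · subst h
    rw [Matrix.blockDiagonal'_apply_eq, A_apply_self]
  · rw [Matrix.blockDiagonal'_apply_ne _ _ _ h, p.A_apply_eq_zero (hp.ne h)]

theorem Nonderogatory.applyT_eq (hp : p.Nonderogatory) (T : Matrix (Fin 3) (Fin 3) ℂ) (k : Fin 3) :
    applyT T ![1, p.J, p.A] k = Matrix.blockDiagonal' fun i =>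
      aeval (jordanBlock (p.size i) 0) (rowPoly T p k i) := by
  rw [hp.A_eq_blockDiagonal', p.J_eq_blockDiagonal', ← Matrix.blockDiagonal'_one]
  simp only [applyT, Fin.sum_univ_three, Matrix.cons_val, ← Matrix.blockDiagonal'_smul,
    ← Matrix.blockDiagonal'_add]
  congr 1
  funext i
  simp [rowPoly, Algebra.algebraMap_eq_smul_one]

end EJAParams

section BlockOf

variable {κ κ' : Type} [Fintype κ] [DecidableEq κ] [Fintype κ'] [DecidableEq κ'] {s : κ → ℕ}
  {s' : κ' → ℕ}

/-- The block of a matrix indexed by pairs (block, position). -/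
def blockOf (K : Matrix (Σ i, Fin (s' i)) (Σ i, Fin (s i)) ℂ) (i' : κ') (i : κ) :
    Matrix (Fin (s' i')) (Fin (s i)) ℂ :=
  Matrix.of fun a b => K ⟨i', a⟩ ⟨i, b⟩

theorem blockOf_mul_blockDiagonal' (K : Matrix (Σ i, Fin (s' i)) (Σ i, Fin (s i)) ℂ)
    (D : ∀ i, Matrix (Fin (s i)) (Fin (s i)) ℂ) (i' : κ') (i : κ) :
    blockOf (K * Matrix.blockDiagonal' D) i' i = blockOf K i' i * D i := by
  ext a b
  simp only [blockOf, Matrix.of_apply, Matrix.mul_apply, Fintype.sum_sigma]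
  rw [Finset.sum_eq_single i]
  · simp
  · intro j _ hj
    exact Finset.sum_eq_zero fun c _ => by rw [Matrix.blockDiagonal'_apply_ne _ _ _ hj, mul_zero]
  · simp

theorem blockOf_blockDiagonal'_mul (K : Matrix (Σ i, Fin (s' i)) (Σ i, Fin (s i)) ℂ)
    (D : ∀ i, Matrix (Fin (s' i)) (Fin (s' i)) ℂ) (i' : κ') (i : κ) :
    blockOf (Matrix.blockDiagonal' D * K) i' i = D i' * blockOf K i' i := by
  ext a b
  simp only [blockOf, Matrix.of_apply, Matrix.mul_apply, Fintype.sum_sigma]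
  rw [Finset.sum_eq_single i']
  · simp
  · intro j _ hj
    exact Finset.sum_eq_zero fun c _ => by
      rw [Matrix.blockDiagonal'_apply_ne _ _ _ hj.symm, zero_mul]
  · simp

theorem blockOf_mul (K : Matrix (Σ i, Fin (s' i)) (Σ i, Fin (s i)) ℂ)
    (K' : Matrix (Σ i, Fin (s i)) (Σ i, Fin (s' i)) ℂ) (i j : κ') :
    blockOf (K * K') i j = ∑ k, blockOf K i k * blockOf K' k j := by
  ext a b
  simp [blockOf, Matrix.mul_apply, Fintype.sum_sigma, Matrix.sum_apply]

theorem blockOf_one (i : κ) :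
    blockOf (1 : Matrix (Σ i, Fin (s i)) (Σ i, Fin (s i)) ℂ) i i = 1 := by
  ext a b
  simp [blockOf, Matrix.one_apply]

theorem exists_blockOf_ne_zero_of_mul_eq_one {K : Matrix (Σ i, Fin (s' i)) (Σ i, Fin (s i)) ℂ}
    {K' : Matrix (Σ i, Fin (s i)) (Σ i, Fin (s' i)) ℂ} (h : K * K' = 1) {i : κ'}
    (hi : 0 < s' i) : ∃ k, blockOf K i k ≠ 0 ∧ blockOf K' k i ≠ 0 := by
  by_contra! hK
  have h1 := congrArg (fun M => blockOf M i i) h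
  simp only [blockOf_mul, blockOf_one] at h1
  rw [Finset.sum_eq_zero] at h1
  · have := congrFun (congrFun h1 ⟨0, hi⟩) ⟨0, hi⟩
    simp at this
  · intro k _
    by_cases hk : blockOf K i k = 0
    · rw [hk, Matrix.zero_mul]
    · rw [hK k hk, Matrix.mul_zero]

end BlockOf

/-- An upper triangular Toeplitz block with zero diagonal has a zero last row. -/
theorem coeff_zero_ne_zero_of_isUnit_blockDiagonal' {κ : Type} [Fintype κ] [DecidableEq κ]
    {s : κ → ℕ} {f : κ → ℂ[X]}
    (h : IsUnit (Matrix.blockDiagonal' fun i => aeval (jordanBlock (s i) 0) (f i))) {i : κ}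
    (hi : 0 < s i) : (f i).coeff 0 ≠ 0 := by
  intro h0
  obtain ⟨R, h1, -⟩ := isILO_iff_isUnit.2 h
  have h2 := congrArg (fun M => blockOf M i i) h1
  simp only [blockOf_blockDiagonal'_mul, blockOf_one] at h2
  have h3 := congrFun (congrFun h2 ⟨s i - 1, by omega⟩) ⟨s i - 1, by omega⟩
  rw [Matrix.mul_apply, Finset.sum_eq_zero, Matrix.one_apply_eq] at h3
  · exact zero_ne_one h3
  · intro k _
    rw [aeval_jordanBlock_zero_apply]
    split_ifs with hk
    · have : (k : ℕ) - (s i - 1) = 0 := by omega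
      simp only [this, h0, zero_mul]
    · rw [zero_mul]

theorem exists_eigenvalue_match {p p' : EJAParams} (hp : p.Nonderogatory)
    {T : Matrix (Fin 3) (Fin 3) ℂ} {P : Matrix p'.Idx p.Idx ℂ}
    (h1 : P * applyT T ![1, p.J, p.A] 1 = p'.J * (P * applyT T ![1, p.J, p.A] 0))
    {i' : Fin p'.r} {i : Fin p.r} (h : blockOf P i' i ≠ 0) :
    (rowPoly T p 1 i).coeff 0 = p'.eig i' * (rowPoly T p 0 i).coeff 0 := by
  by_contra hne
  refine h (eq_zero_of_jordanBlock_intertwine ?_ hne)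
  rw [hp.applyT_eq, hp.applyT_eq, p'.J_eq_blockDiagonal'] at h1
  have h2 := congrArg (fun M => blockOf M i' i) h1
  simpa only [blockOf_mul_blockDiagonal', blockOf_blockDiagonal'_mul] using h2

/-- Each block row of P has a nonzero block, and its column determines the eigenvalue of the row as
a quotient of constant terms; distinct eigenvalues make this choice of columns injective. -/
theorem TripleSymmetry.r_le {p p' : EJAParams} (hp : p.Nonderogatory) (hp' : p'.Nonderogatory)
    (h : TripleSymmetry p p') : p'.r ≤ p.r := by
  obtain ⟨T, -, hG, P, ⟨R, hPR, -⟩, h1, -⟩ := (tripleSymmetry_iff_exists p p').1 h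
  rw [hp.applyT_eq] at hG
  choose f hf using fun i' => exists_blockOf_ne_zero_of_mul_eq_one hPR (p'.size_pos i')
  have hinj : Function.Injective f := by
    intro i' j' hij
    have e1 := exists_eigenvalue_match hp h1 (hf i').1
    have e2 := exists_eigenvalue_match hp h1 (hf j').1
    rw [hij] at e1
    have hne := coeff_zero_ne_zero_of_isUnit_blockDiagonal' hG (p.size_pos (f j'))
    exact hp' (mul_right_cancel₀ hne (e1.symm.trans e2))
  simpa using Fintype.card_le_of_injective f hinj

theorem TripleSymmetry.symm {p p' : EJAParams} (h : TripleSymmetry p p') : TripleSymmetry p' p :=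
  (tripleSymmetry_iff p' p).2 ((tripleSymmetry_iff p p').1 h).symm

/-- Matching eigenvalues leave one nonzero block of P in each block column, so P is a block
permutation along σ whose blocks are invertible; each block then yields its own substitution g. -/
theorem TripleSymmetry.explicitSymmetry {p p' : EJAParams} (hp : p.Nonderogatory)
    (hp' : p'.Nonderogatory) (h : TripleSymmetry p p') : ExplicitSymmetry p p' := by
  have hr : p.r = p'.r := le_antisymm (h.symm.r_le hp' hp) (h.r_le hp hp')
  obtain ⟨T, hT, hG, P, ⟨R, hPR, hRP⟩, h1, h2⟩ := (tripleSymmetry_iff_exists p p').1 h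
  rw [hp.applyT_eq] at hG
  have hf0 : ∀ i, (rowPoly T p 0 i).coeff 0 ≠ 0 := fun i =>
    coeff_zero_ne_zero_of_isUnit_blockDiagonal' hG (p.size_pos i)
  choose σ hσ' using fun i => exists_blockOf_ne_zero_of_mul_eq_one hRP (p.size_pos i)
  have hσ := fun i => (hσ' i).2
  have huniq : ∀ {i i'}, blockOf P i' i ≠ 0 → i' = σ i := by
    intro i i' hne
    have e1 := exists_eigenvalue_match hp h1 hne
    have e2 := exists_eigenvalue_match hp h1 (hσ i)
    exact hp' (mul_right_cancel₀ (hf0 i) (e1.symm.trans e2))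
  have hsurj : Function.Surjective σ := by
    intro i'
    obtain ⟨i, hi, -⟩ := exists_blockOf_ne_zero_of_mul_eq_one hPR (p'.size_pos i')
    exact ⟨i, (huniq hi).symm⟩
  have hbij : Function.Bijective σ := by
    rw [Fintype.bijective_iff_surjective_and_card]
    exact ⟨hsurj, by simpa using hr⟩
  refine ⟨T, Equiv.ofBijective σ hbij, hT, fun i => ?_⟩
  have hRPi : blockOf R i (σ i) * blockOf P (σ i) i = 1 := by
    have e := congrArg (fun M => blockOf M i i) hRP
    simp only [blockOf_mul, blockOf_one] at e
    rw [Finset.sum_eq_single (σ i)] at e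
    · exact e
    · intro j _ hj
      rw [not_ne_iff.1 (mt huniq hj), Matrix.mul_zero]
    · simp
  have hPRi : blockOf P (σ i) i * blockOf R i (σ i) = 1 := by
    have e := congrArg (fun M => blockOf M (σ i) (σ i)) hPR
    simp only [blockOf_mul, blockOf_one] at e
    rw [Finset.sum_eq_single i] at e
    · exact e
    · intro j _ hj
      rw [not_ne_iff.1 (mt huniq fun h => hj (hbij.1 h).symm), Matrix.zero_mul]
    · simp
  rw [hp.applyT_eq, hp.applyT_eq, p'.J_eq_blockDiagonal'] at h1
  rw [hp.applyT_eq, hp.applyT_eq, hp'.A_eq_blockDiagonal'] at h2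
  have e1 := congrArg (fun M => blockOf M (σ i) i) h1
  have e2 := congrArg (fun M => blockOf M (σ i) i) h2
  simp only [blockOf_mul_blockDiagonal', blockOf_blockDiagonal'_mul] at e1 e2
  obtain ⟨hn, g, hg⟩ := exists_substitution_of_intertwine (p.size_pos i) hPRi hRPi (hf0 i) e1 e2
  exact ⟨hn, hf0 i, g, hg⟩

/-- The block diagonal matrix of the S_i, where S_i replaces x by g_i(x) under conjugation, converts
the congruences into the intertwining equations. -/
theorem ExplicitSymmetry.tripleSymmetry {p p' : EJAParams} (hp : p.Nonderogatory)
    (hp' : p'.Nonderogatory) (h : ExplicitSymmetry p p') : TripleSymmetry p p' := by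
  obtain ⟨T, σ, hT, h⟩ := h
  choose hsize hf0 g hg0 hg1 hd1 hd2 using h
  rw [tripleSymmetry_iff, sloccEquiv_iff]
  refine ⟨T, hT, ?_⟩
  -- Relabelling along σ makes both triples block diagonal over the same index type.
  let e : p.Idx ≃ p'.Idx := Equiv.sigmaCongr σ fun i => finCongr (hsize i).symm
  have he : ∀ i a, e ⟨i, a⟩ = ⟨σ i, finCongr (hsize i).symm a⟩ := fun i a => rfl
  have hJ : p'.J.submatrix e e = Matrix.blockDiagonal' fun i =>
      aeval (jordanBlock (p.size i) 0) (C (p'.eig (σ i)) + X) := by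
    simp only [aeval_jordanBlock_C_add_X]
    ext ⟨i, a⟩ ⟨j, b⟩
    rw [Matrix.submatrix_apply, he, he, p'.J_apply]
    by_cases hij : i = j
    · subst hij
      simp [jordanBlock, Fin.ext_iff]
    · simp [Matrix.blockDiagonal'_apply_ne _ _ _ hij, hij]
  have hA : p'.A.submatrix e e = Matrix.blockDiagonal' fun i =>
      aeval (jordanBlock (p.size i) 0) (p'.blockPoly (σ i)) := by
    ext ⟨i, a⟩ ⟨j, b⟩
    rw [Matrix.submatrix_apply, he, he]
    by_cases hij : i = j
    · subst hij
      rw [Matrix.blockDiagonal'_apply_eq, EJAParams.A_apply_self, aeval_jordanBlock_zero_apply,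
        aeval_jordanBlock_zero_apply]
      rfl
    · rw [Matrix.blockDiagonal'_apply_ne _ _ _ hij, p'.A_apply_eq_zero]
      exact fun h => hij (σ.injective (hp' h))
  suffices hPQ : PQEquiv (applyT T ![1, p.J, p.A]) ![1, p'.J.submatrix e e, p'.A.submatrix e e] by
    refine hPQ.trans (PQEquiv.symm ?_)
    convert pqEquiv_submatrix ![1, p'.J, p'.A] e using 1
    funext j
    fin_cases j
    · simp
    · rfl
    · rfl
  choose S hS hSJ using fun i => exists_conj_jordanBlock (hg0 i) (hg1 i) (p.size i)
  have hSf : ∀ i (f : ℂ[X]), S i * aeval (jordanBlock (p.size i) 0) f =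
      aeval (jordanBlock (p.size i) 0) (f.comp (g i)) * S i := by
    intro i f
    obtain ⟨S', h1, h2⟩ := isILO_iff_isUnit.2 (hS i)
    have h3 : aeval (jordanBlock (p.size i) 0) (g i) = S i * jordanBlock (p.size i) 0 * S' := by
      rw [hSJ, Matrix.mul_assoc, h1, Matrix.mul_one]
    rw [aeval_comp, h3, aeval_conj h1 h2, Matrix.mul_assoc, h2, Matrix.mul_one]
  choose S' hSS' hS'S using fun i => isILO_iff_isUnit.2 (hS i)
  choose v hv using fun i => exists_aeval_jordanBlock_mul_eq_one (hf0 i) (p.size i)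
  rw [hJ, hA, pqEquiv_triple_iff]
  simp only [hp.applyT_eq]
  refine ⟨isILO_iff_isUnit.1 ⟨Matrix.blockDiagonal' fun i =>
      aeval (jordanBlock (p.size i) 0) (v i), ?_, ?_⟩, Matrix.blockDiagonal' S,
    ⟨Matrix.blockDiagonal' S', ?_, ?_⟩, ?_, ?_⟩
  · rw [← Matrix.blockDiagonal'_mul]
    simp only [hv]
    exact Matrix.blockDiagonal'_one
  · rw [← Matrix.blockDiagonal'_mul]
    simp only [← map_mul, mul_comm (v _)]
    simp only [map_mul, hv]
    exact Matrix.blockDiagonal'_one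
  · rw [← Matrix.blockDiagonal'_mul]
    simp only [hSS']
    exact Matrix.blockDiagonal'_one
  · rw [← Matrix.blockDiagonal'_mul]
    simp only [hS'S]
    exact Matrix.blockDiagonal'_one
  · simp only [← Matrix.blockDiagonal'_mul]
    congr 1
    funext i
    have h1 := (aeval_jordanBlock_zero_eq_zero_iff _).2 (hd1 i)
    rw [map_sub, sub_eq_zero] at h1
    rw [hSf, hSf, h1, map_mul, Matrix.mul_assoc]
  · simp only [← Matrix.blockDiagonal'_mul]
    congr 1
    funext i
    have h1 := (aeval_jordanBlock_zero_eq_zero_iff _).2 (hd2 i)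
    rw [map_sub, sub_eq_zero] at h1
    rw [hSf, hSf, h1, map_mul, Matrix.mul_assoc]

end ExplicitSymmetry

theorem mainTheorem1 :
    -- `A` commutes with `J`
    (∀ p : EJAParams, Commute p.J p.A) ∧
    -- reduction of simultaneous similarity to a commuting pair
    (∀ (l n : ℕ) (γ γ' : Fin l → Matrix (Fin n) (Fin n) ℂ),
      Commute (pairX l n) (pairY γ) ∧
      (PQEquiv (consTuple 1 γ) (consTuple 1 γ') ↔ SimSimilar γ γ') ∧
      (SimSimilar γ γ' ↔
        SimSimilar ![pairX l n, pairY γ] ![pairX l n, pairY γ'])) ∧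
    -- every state has a canonical form
    (∀ (l N : ℕ) (Γ : Fin (l + 1) → Matrix (Fin N) (Fin N) ℂ),
      ∃ c : CanonicalData l, IsCanonicalForm Γ c) ∧
    -- shape of the canonical forms
    (∀ (l N : ℕ) (Γ : Fin (l + 1) → Matrix (Fin N) (Fin N) ℂ) (c : CanonicalData l),
      IsCanonicalForm Γ c →
        c.n + c.m = N ∧
        IsGreatest (Set.range fun t : Fin (l + 1) → ℂ => (∑ j, t j • Γ j).rank) (N - c.i) ∧
        (c.i = 0 ↔ c.m = 0) ∧
        IsGreatest (Set.range fun α : Fin l → ℂ =>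
          (lambdaPrime c.m c.i + ∑ j, α j • c.β j).rank) (c.m - c.i) ∧
        ((∃ j, c.β j ≠ 0) → c.i < c.m) ∧
        (((∀ v : Fin N → ℂ, (∀ j, Matrix.mulVec (Γ j) v = 0) → v = 0) ∨
            (∀ v : Fin N → ℂ, (∀ j, Matrix.vecMul v (Γ j) = 0) → v = 0)) →
          0 < c.i → ∃ j, c.β j ≠ 0)) ∧
    -- two states are equivalent if and only if their canonical forms are related by the symmetry
    (∀ (l N : ℕ) (Γ Γ' : Fin (l + 1) → Matrix (Fin N) (Fin N) ℂ) (c c' : CanonicalData l),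
      IsCanonicalForm Γ c → IsCanonicalForm Γ' c' →
        (SLOCCEquiv Γ Γ' ↔ ParametricSymmetry c c')) ∧
    -- triples that become `(E, A₂, A₃)` with commuting `A₂`, `A₃` need no composed pair
    (∀ (N : ℕ) (Γ : Fin 3 → Matrix (Fin N) (Fin N) ℂ), IsUnit (Γ 0) →
      Commute ((Γ 0)⁻¹ * Γ 1) ((Γ 0)⁻¹ * Γ 2) →
        ∃ p : EJAParams, PQEquiv Γ ![1, p.J, p.A]) ∧
    (∀ (N : ℕ) (Γ Γ' : Fin 3 → Matrix (Fin N) (Fin N) ℂ) (p p' : EJAParams),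
      PQEquiv Γ ![1, p.J, p.A] → PQEquiv Γ' ![1, p'.J, p'.A] →
        (SLOCCEquiv Γ Γ' ↔ TripleSymmetry p p') ∧
        (p.Nonderogatory → p'.Nonderogatory →
          (SLOCCEquiv Γ Γ' ↔ ExplicitSymmetry p p'))) := by
  refine ⟨fun p => p.commute_J_A, fun l n γ γ' => ⟨commute_pairX_pairY γ,
    pqEquiv_consTuple_one_iff, simSimilar_pair_of_simSimilar, simSimilar_of_simSimilar_pair⟩,
    fun l N Γ => exists_isCanonicalForm Γ, fun l N Γ c h => ⟨h.add_eq, h.isGreatest_rank,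
      h.i_eq_zero_iff, h.isGreatest_rank_beta, h.i_lt, h.exists_beta_ne_zero⟩,
    fun l N Γ Γ' c c' h h' => ⟨h.parametricSymmetry h', h.sloccEquiv h'⟩,
    fun N Γ h0 h => exists_pqEquiv_triple h0 h, fun N Γ Γ' p p' h h' =>
      ⟨sloccEquiv_iff_tripleSymmetry h h', fun hp hp' => ?_⟩⟩
  rw [sloccEquiv_iff_tripleSymmetry h h']
  exact ⟨fun hs => hs.explicitSymmetry hp hp', fun hs => hs.tripleSymmetry hp hp'⟩
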